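/- Let $n,d\in\mathbb N$, $\tau>0$, $\epsilon>0$ and $A_0,A_1\in\mathbb R^{n\times n}$. Write $I=[-\tau,0]$. \textbf{The set $\Xi_{d,k,1}$.} Let $Y_d(s)$ and $Y_d(s,\theta)$ be the vectors of monomials of (total) degree at most $d$, and put $Y_1(s)=Y_d(s)\otimes I_k$, $Y_2(s,\theta)=Y_d(s,\theta)\otimes I_k$. For $g:I\to\mathbb R$ and a positive semidefinite matrix $Q=\begin{bmatrix}Q_{11}&Q_{12}\\Q_{12}^T&Q_{22}\end{bmatrix}$ of compatible size let $$M_{g,Q}(s)=g(s)Y_1(s)^TQ_{11}Y_1(s),$$ $$N_{g,Q}(s,\theta)=g(s)Y_1(s)^TQ_{12}Y_2(s,\theta)+g(\theta)Y_2(\theta,s)^TQ_{12}^TY_1(\theta)+\int_{-\tau}^0 g(\omega)Y_2(\omega,s)^TQ_{22}Y_2(\omega,\theta)\,d\omega .$$ Then $\{M,N\}\in\Xi_{d,k,1}$ means that $M=M_{1,Q}+M_{g,Q'}$ and $N=N_{1,Q}+N_{g,Q'}$ (almost everywhere on $I$, respectively $I\times I$) for some positive semidefinite $Q,Q'$, where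 $g(s)=-s(s+\tau)$. \textbf{The set $\Theta_{m,k,1}$.} $\{F,H\}\in\Theta_{m,k,1}$ means that there are square-integrable functions $K:I\to\mathbb R^{m\times m}$, $L_{11}:I^2\to\mathbb R^{m\times m}$, $L_{12}:I^2\to\mathbb R^{m\times k}$, $L_{21}:I^2\to\mathbb R^{k\times m}$ with $\int_{-\tau}^0K(s)\,ds=0$ such that, almost everywhere, $$F(s)=\begin{bmatrix}K(s)+\frac1\tau\int_{-\tau}^0\int_{-\tau}^0L_{11}(\omega,t)\,d\omega\,dt&\int_{-\tau}^0L_{12}(\omega,s)\,d\omega\\ \int_{-\tau}^0L_{21}(s,\omega)\,d\omega&0\end{bmatrix},\qquad H(s,\theta)=-\begin{bmatrix}L_{11}(s,\theta)&L_{12}(s,\theta)\\L_{21}(s,\theta)&0\end{bmatrix}.$$ \textbf{Theorem.} Let $S:I\to\mathbb R^{n\times n}$ and $R:I\times I\to\mathbb R^{n\times n}$ be continuous with first-order weak derivatives in $L_2$, and suppose that $S(s)=S(s)^T$ and $R(s,\theta)=R(\theta,s)^T$ for all $s,\theta\in I$. Let $\{F_1,H_1\}\in\Theta_{n,n,1}$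 and $\{F_2,H_2\}\in\Theta_{2n,n,1}$. Put $$M(s)=\begin{bmatrix}\tau R(0,0)+\tau S(0)&\tau R(0,s)\\ \tau R(s,0)&\tau S(s)\end{bmatrix}+F_1(s)-\epsilon I_{2n},\qquad N(s,\theta)=\begin{bmatrix}0_n&0_n\\0_n&R(s,\theta)\end{bmatrix}+H_1(s,\theta),$$ $$D(s)=\begin{bmatrix}D_0&\tau V(s)\\ \tau V(s)^T&\tau\dot S(s)+\epsilon I_n\end{bmatrix}+F_2(s),\qquad E(s,\theta)=\begin{bmatrix}0_{2n}&0_{2n,n}\\0_{n,2n}&G(s,\theta)\end{bmatrix}+H_2(s,\theta),$$ where $$D_0=\begin{bmatrix}S_{11}+S_{11}^T+\epsilon I_n&S_{12}\\S_{12}^T&S_{22}\end{bmatrix},\quad V(s)=\begin{bmatrix}S_{13}(s)\\0_n\end{bmatrix},\quad G(s,\theta)=\frac{\partial R}{\partial s}(s,\theta)+\frac{\partial R}{\partial\theta}(s,\theta),$$ $$S_{11}=\tau A_0(R(0,0)+S(0))+\tau A_1R(-\tau,0)+\tfrac12S(0),\quad S_{12}=\tau A_1S(-\tau),\quad S_{22}=-S(-\tau),$$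 $$S_{13}(s)=A_0R(0,s)+A_1R(-\tau,s)+\Big(\frac{d}{ds}R(s,0)\Big)^T .$$ If $\{M,N\}\in\Xi_{d,2n,1}$ and $\{-D,-E\}\in\Xi_{d,3n,1}$, then the delay equation $$\dot x(t)=A_0x(t)+A_1x(t-\tau)\ \ (t\ge0),\qquad x(t)=\phi(t)\ \ (t\in[-\tau,0]),\qquad \phi\in C([-\tau,0];\mathbb R^n),$$ is exponentially stable: there are $C,\alpha>0$ such that every solution, for every initial function $\phi$, satisfies $\|x(t)\|\le Ce^{-\alpha t}\sup_{s\in[-\tau,0]}\|\phi(s)\|$ for all $t\ge0$. -/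

import Mathlib

open MeasureTheory Set Matrix
open scoped ContDiff

noncomputable section

/-! ### Sobolev spaces `W₂` -/

/-- `g` is the weak derivative of `f` in the direction `v` on the open set `U`. -/
def HasWeakDerivOn {E : Type*} [NormedAddCommGroup E] [NormedSpace ℝ E] [MeasureSpace E]
    (U : Set E) (v : E) (f g : E → ℝ) : Prop :=
  ∀ φ : E → ℝ, ContDiff ℝ ∞ φ → HasCompactSupport φ → tsupport φ ⊆ U →
    ∫ x in U, f x * fderiv ℝ φ x v = -∫ x in U, g x * φ x

/-- The space `W₂[X]`: the function and its first-order weak derivatives are square integrable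
on `X`. As point values are used, a member is a function that is continuous on `X`
(the continuous representative), not an almost-everywhere class. -/
def MemW2 {E : Type*} [NormedAddCommGroup E] [NormedSpace ℝ E] [MeasureSpace E]
    (X : Set E) (f : E → ℝ) : Prop :=
  ContinuousOn f X ∧ MemLp f 2 (volume.restrict X) ∧
    ∀ v : E, ∃ g : E → ℝ, MemLp g 2 (volume.restrict X) ∧ HasWeakDerivOn (interior X) v f g

/-- The interval `[-τ, 0]`. -/
def delayInterval (τ : ℝ) : Set ℝ := Icc (-τ) 0

/-- The square `[-τ, 0] × [-τ, 0]`. -/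
def delaySquare (τ : ℝ) : Set (ℝ × ℝ) := delayInterval τ ×ˢ delayInterval τ

/-- Entrywise integral over `[-τ, 0]` of a matrix-valued function. -/
def matIntegral {α β : Type*} (τ : ℝ) (f : ℝ → Matrix α β ℝ) : Matrix α β ℝ :=
  Matrix.of fun i j => ∫ s in delayInterval τ, f s i j

/-- Entrywise derivative of a matrix-valued function. -/
def matDeriv {α β : Type*} (f : ℝ → Matrix α β ℝ) (s : ℝ) : Matrix α β ℝ :=
  Matrix.of fun i j => deriv (fun σ => f σ i j) s

/-! ### Positive multiplier and kernel pairs -/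

/-- Exponents of the monomials of total degree at most `d` in two variables. -/
abbrev BiDegree (d : ℕ) : Type := {p : Fin (d + 1) × Fin (d + 1) // p.1.val + p.2.val ≤ d}

/-- `Y_d(s) ⊗ I`, with `Y_d(s)` the vector of monomials of degree at most `d` in `s`. -/
def basisOne (ι : Type) [DecidableEq ι] (d : ℕ) (s : ℝ) : Matrix (Fin (d + 1) × ι) ι ℝ :=
  Matrix.of fun a j => s ^ a.1.val * (1 : Matrix ι ι ℝ) a.2 j

/-- `Y_d(s, θ) ⊗ I`, with `Y_d(s, θ)` the vector of monomials of degree at most `d` in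
`(s, θ)`. -/
def basisTwo (ι : Type) [DecidableEq ι] (d : ℕ) (s θ : ℝ) : Matrix (BiDegree d × ι) ι ℝ :=
  Matrix.of fun a j =>
    s ^ a.1.val.1.val * θ ^ a.1.val.2.val * (1 : Matrix ι ι ℝ) a.2 j

/-- `M(s) = g(s) Y₁(s)ᵀ Q₁₁ Y₁(s)`. -/
def sosMultiplier {ι : Type} [Fintype ι] [DecidableEq ι] (d : ℕ) (g : ℝ → ℝ)
    (Q₁₁ : Matrix (Fin (d + 1) × ι) (Fin (d + 1) × ι) ℝ) (s : ℝ) : Matrix ι ι ℝ :=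
  g s • ((basisOne ι d s)ᵀ * Q₁₁ * basisOne ι d s)

/-- `N(s, θ) = g(s) Y₁(s)ᵀ Q₁₂ Y₂(s, θ) + g(θ) Y₂(θ, s)ᵀ Q₁₂ᵀ Y₁(θ)
  + ∫ g(η) Y₂(η, s)ᵀ Q₂₂ Y₂(η, θ) dη`, the integral being over `[-τ, 0]`. -/
def sosKernel {ι : Type} [Fintype ι] [DecidableEq ι] (τ : ℝ) (d : ℕ) (g : ℝ → ℝ)
    (Q₁₂ : Matrix (Fin (d + 1) × ι) (BiDegree d × ι) ℝ)
    (Q₂₂ : Matrix (BiDegree d × ι) (BiDegree d × ι) ℝ) (s θ : ℝ) : Matrix ι ι ℝ :=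
  g s • ((basisOne ι d s)ᵀ * Q₁₂ * basisTwo ι d s θ)
    + g θ • ((basisTwo ι d θ s)ᵀ * Q₁₂ᵀ * basisOne ι d θ)
    + matIntegral τ fun η => g η • ((basisTwo ι d η s)ᵀ * Q₂₂ * basisTwo ι d η θ)

/-- The pair `{M, N}` is given on the interval by a positive semidefinite matrix `Q` through
the formulas above, with weight `g`. -/
def IsSosPair {ι : Type} [Fintype ι] [DecidableEq ι] (τ : ℝ) (d : ℕ) (g : ℝ → ℝ)
    (M : ℝ → Matrix ι ι ℝ) (N : ℝ → ℝ → Matrix ι ι ℝ) : Prop :=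
  ∃ (Q₁₁ : Matrix (Fin (d + 1) × ι) (Fin (d + 1) × ι) ℝ)
    (Q₁₂ : Matrix (Fin (d + 1) × ι) (BiDegree d × ι) ℝ)
    (Q₂₂ : Matrix (BiDegree d × ι) (BiDegree d × ι) ℝ),
    (Matrix.fromBlocks Q₁₁ Q₁₂ Q₁₂ᵀ Q₂₂).PosSemidef ∧
    (∀ s, M s = sosMultiplier d g Q₁₁ s) ∧
    (∀ s θ, N s θ = sosKernel τ d g Q₁₂ Q₂₂ s θ)

/-- The set `Ξ_{d,k,1}` on `[-τ, 0]`, where `k` is the cardinality of `ι`: sums of a pair with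
weight `1` and a pair with weight `-s (s + τ)`. Multipliers and kernels are identified when they
agree almost everywhere. -/
def Xi {ι : Type} [Fintype ι] [DecidableEq ι] (τ : ℝ) (d : ℕ) :
    Set ((ℝ → Matrix ι ι ℝ) × (ℝ → ℝ → Matrix ι ι ℝ)) :=
  {P | ∃ (M₁ M₂ : ℝ → Matrix ι ι ℝ) (N₁ N₂ : ℝ → ℝ → Matrix ι ι ℝ),
    IsSosPair τ d (fun _ => 1) M₁ N₁ ∧
    IsSosPair τ d (fun s => -(s * (s + τ))) M₂ N₂ ∧
    (∀ᵐ s ∂(volume.restrict (delayInterval τ)), P.1 s = M₁ s + M₂ s) ∧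
    (∀ᵐ p ∂(volume.restrict (delaySquare τ)), P.2 p.1 p.2 = N₁ p.1 p.2 + N₂ p.1 p.2)}

/-! ### Spacing functions -/

/-- The set `Θ_{m,k,1}` on `[-τ, 0]`, where `m` and `k` are the cardinalities of `μ` and `ν`.
The functions `F` and `H` are identified when they agree almost everywhere. -/
def Theta {μ ν : Type} (τ : ℝ) :
    Set ((ℝ → Matrix (μ ⊕ ν) (μ ⊕ ν) ℝ) × (ℝ → ℝ → Matrix (μ ⊕ ν) (μ ⊕ ν) ℝ)) :=
  {P | ∃ (K : ℝ → Matrix μ μ ℝ) (L₁₁ : ℝ → ℝ → Matrix μ μ ℝ)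
    (L₁₂ : ℝ → ℝ → Matrix μ ν ℝ) (L₂₁ : ℝ → ℝ → Matrix ν μ ℝ),
    (∀ i j, MemLp (fun s => K s i j) 2 (volume.restrict (delayInterval τ))) ∧
    (∀ i j, MemLp (fun p : ℝ × ℝ => L₁₁ p.1 p.2 i j) 2 (volume.restrict (delaySquare τ))) ∧
    (∀ i j, MemLp (fun p : ℝ × ℝ => L₁₂ p.1 p.2 i j) 2 (volume.restrict (delaySquare τ))) ∧
    (∀ i j, MemLp (fun p : ℝ × ℝ => L₂₁ p.1 p.2 i j) 2 (volume.restrict (delaySquare τ))) ∧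
    matIntegral τ K = 0 ∧
    (∀ᵐ s ∂(volume.restrict (delayInterval τ)), P.1 s =
      Matrix.fromBlocks
        (K s + τ⁻¹ • matIntegral τ fun t => matIntegral τ fun η => L₁₁ η t)
        (matIntegral τ fun η => L₁₂ η s)
        (matIntegral τ fun η => L₂₁ s η)
        0) ∧
    (∀ᵐ p ∂(volume.restrict (delaySquare τ)), P.2 p.1 p.2 =
      -Matrix.fromBlocks (L₁₁ p.1 p.2) (L₁₂ p.1 p.2) (L₂₁ p.1 p.2) 0)}

/-! ### The multipliers and kernels of the dual stability condition -/

section DualData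

variable {n : ℕ} (τ ε : ℝ) (A₀ A₁ : Matrix (Fin n) (Fin n) ℝ)
  (S : ℝ → Matrix (Fin n) (Fin n) ℝ) (R : ℝ → ℝ → Matrix (Fin n) (Fin n) ℝ)

/-- `M(s)`. -/
def dualM (F₁ : ℝ → Matrix (Fin n ⊕ Fin n) (Fin n ⊕ Fin n) ℝ) (s : ℝ) :
    Matrix (Fin n ⊕ Fin n) (Fin n ⊕ Fin n) ℝ :=
  Matrix.fromBlocks (τ • R 0 0 + τ • S 0) (τ • R 0 s) (τ • R s 0) (τ • S s) + F₁ s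
    - ε • (1 : Matrix (Fin n ⊕ Fin n) (Fin n ⊕ Fin n) ℝ)

/-- `N(s, θ)`. -/
def dualN (H₁ : ℝ → ℝ → Matrix (Fin n ⊕ Fin n) (Fin n ⊕ Fin n) ℝ) (s θ : ℝ) :
    Matrix (Fin n ⊕ Fin n) (Fin n ⊕ Fin n) ℝ :=
  Matrix.fromBlocks 0 0 0 (R s θ) + H₁ s θ

/-- `S₁₁`. -/
def dualS11 : Matrix (Fin n) (Fin n) ℝ :=
  τ • (A₀ * (R 0 0 + S 0)) + τ • (A₁ * R (-τ) 0) + (1 / 2 : ℝ) • S 0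

/-- `S₁₂`. -/
def dualS12 : Matrix (Fin n) (Fin n) ℝ := τ • (A₁ * S (-τ))

/-- `S₂₂`. -/
def dualS22 : Matrix (Fin n) (Fin n) ℝ := -S (-τ)

/-- `S₁₃(s)`; its last term is the transpose of the derivative of `s ↦ R(s, 0)`. -/
def dualS13 (s : ℝ) : Matrix (Fin n) (Fin n) ℝ :=
  A₀ * R 0 s + A₁ * R (-τ) s + (matDeriv (fun σ => R σ 0) s)ᵀ

/-- `D₀`. -/
def dualD0 : Matrix (Fin n ⊕ Fin n) (Fin n ⊕ Fin n) ℝ :=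
  Matrix.fromBlocks
    (dualS11 τ A₀ A₁ S R + (dualS11 τ A₀ A₁ S R)ᵀ + ε • (1 : Matrix (Fin n) (Fin n) ℝ))
    (dualS12 τ A₁ S) (dualS12 τ A₁ S)ᵀ (dualS22 τ S)

/-- `V(s)`. -/
def dualV (s : ℝ) : Matrix (Fin n ⊕ Fin n) (Fin n) ℝ :=
  Matrix.fromRows (dualS13 τ A₀ A₁ R s) 0

/-- `D(s)`. -/
def dualD (F₂ : ℝ → Matrix ((Fin n ⊕ Fin n) ⊕ Fin n) ((Fin n ⊕ Fin n) ⊕ Fin n) ℝ) (s : ℝ) :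
    Matrix ((Fin n ⊕ Fin n) ⊕ Fin n) ((Fin n ⊕ Fin n) ⊕ Fin n) ℝ :=
  Matrix.fromBlocks (dualD0 τ ε A₀ A₁ S R) (τ • dualV τ A₀ A₁ R s)
    (τ • (dualV τ A₀ A₁ R s)ᵀ) (τ • matDeriv S s + ε • (1 : Matrix (Fin n) (Fin n) ℝ)) + F₂ s

/-- `G(s, θ) = ∂R/∂s + ∂R/∂θ`. -/
def dualG (s θ : ℝ) : Matrix (Fin n) (Fin n) ℝ :=
  matDeriv (fun σ => R σ θ) s + matDeriv (fun ϑ => R s ϑ) θ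

/-- `E(s, θ)`. -/
def dualE (H₂ : ℝ → ℝ → Matrix ((Fin n ⊕ Fin n) ⊕ Fin n) ((Fin n ⊕ Fin n) ⊕ Fin n) ℝ)
    (s θ : ℝ) : Matrix ((Fin n ⊕ Fin n) ⊕ Fin n) ((Fin n ⊕ Fin n) ⊕ Fin n) ℝ :=
  Matrix.fromBlocks 0 0 0 (dualG R s θ) + H₂ s θ

end DualData

/-! ### The delay equation -/

/-- `x` solves `ẋ(t) = A₀ x(t) + A₁ x(t - τ)` for `t ≥ 0` (one-sided derivative at `t = 0`),
with initial function `φ ∈ C[-τ, 0]`. -/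
structure IsDelaySolution {n : ℕ} (τ : ℝ) (A₀ A₁ : Matrix (Fin n) (Fin n) ℝ)
    (φ : C(Icc (-τ) (0 : ℝ), EuclideanSpace ℝ (Fin n)))
    (x : ℝ → EuclideanSpace ℝ (Fin n)) : Prop where
  continuousOn : ContinuousOn x (Ici (-τ))
  initial : ∀ s : Icc (-τ) (0 : ℝ), x s = φ s
  equation : ∀ t : ℝ, 0 ≤ t →
    HasDerivWithinAt x (WithLp.toLp 2 (A₀ *ᵥ x t + A₁ *ᵥ x (t - τ))) (Ici 0) t

/-- Exponential stability: `‖x(t)‖ ≤ C e^{-α t} sup ‖φ‖` for all solutions and all `t ≥ 0`, with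
`C, α > 0` independent of the initial function `φ`. -/
def IsExponentiallyStable {n : ℕ} (τ : ℝ) (A₀ A₁ : Matrix (Fin n) (Fin n) ℝ) : Prop :=
  ∃ C α : ℝ, 0 < C ∧ 0 < α ∧
    ∀ (φ : C(Icc (-τ) (0 : ℝ), EuclideanSpace ℝ (Fin n))) (x : ℝ → EuclideanSpace ℝ (Fin n)),
      IsDelaySolution τ A₀ A₁ φ x → ∀ t : ℝ, 0 ≤ t → ‖x t‖ ≤ C * Real.exp (-α * t) * ‖φ‖

end

/-! The proof is a dual Lyapunov argument. On E × L²[-τ,0] put P(x,z) = (τ(τ(R(0,0)+S(0))x +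
∫R(0,s)z(s)ds), τR(s,0)x + τS(s)z(s) + ∫R(s,θ)z(θ)dθ). The symmetry of S and R makes P self-adjoint
and the form of {M,N} makes it coercive, so P is invertible. A solution is recorded as Y(t) =
(τx(t), x(t+·)), and the Lyapunov function is V = ⟨Y, P⁻¹Y⟩.

No formula for P⁻¹ is needed. With k = P⁻¹Y = (ξ,z), self-adjointness gives V' = 2⟨k,Y'⟩. P is
shaped so that, when the segment is C¹, Pk = Y forces z to have a C¹ representative w with w(0) = ξ
(`exists_representative`). Differentiating the identity Pk = Y, inserting the delay equation and
integrating ⟨w,Sw'⟩ by parts turns 2⟨k,Y'⟩ into the form of {D,E} at (ξ, w(-τ), w) without its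
ε-terms, whence V' ≤ -ε(τ‖ξ‖² + ‖z‖²) (`inner_deriv_le`). Since V is bounded by a multiple of ‖k‖²,
V decays exponentially from t = τ on; Gronwall's inequality covers [0,τ]
(`IsDualCertificate.exponentially_stable`).

The integral inequalities behind this come from Ξ and Θ. For an SOS pair put a(η) = Y₁(η)v(η) and
b(η) = ∫Y₂(η,θ)v(θ)dθ; Fubini identifies its form with ∫g·(a,b)ᵀQ(a,b) ≥ 0
(`IsSosPair.form_nonneg`). Spacing functions contribute zero because the first block of the test
vector is constant in s (`Theta.form_eq_zero`).

Regularity is also supplied by Ξ. The lower right blocks of spacing functions vanish, so τS - εI and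
R agree almost everywhere with blocks of polynomial matrices, and by continuity everywhere on the
interval and the square. They can therefore be replaced by symmetric C¹ functions on the whole line
and plane. Pointwise positivity of the multiplier gives τS(s) ≥ εI, the invertibility needed to
solve for w. -/

noncomputable section

/-! ### Operators on `L²[-τ, 0]` -/

/-- Lebesgue measure on `[-τ, 0]`. -/
abbrev delayMeasure (τ : ℝ) : Measure ℝ := volume.restrict (Icc (-τ) 0)

section LtwoOperators

variable {E : Type*} [NormedAddCommGroup E]

theorem ae_mem_delayInterval (τ : ℝ) : ∀ᵐ s ∂(delayMeasure τ), s ∈ Icc (-τ) (0 : ℝ) :=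
  ae_restrict_mem measurableSet_Icc

theorem measureReal_delay {τ : ℝ} (hτ : 0 ≤ τ) : (delayMeasure τ).real univ = τ := by
  rw [measureReal_restrict_apply_univ, Real.volume_real_Icc_of_le (by linarith)]; ring

theorem exists_norm_le_of_continuous {F : Type*} [NormedAddCommGroup F] (τ : ℝ) {f : ℝ → F}
    (hf : Continuous f) : ∃ C, 0 ≤ C ∧ ∀ s ∈ Icc (-τ) (0 : ℝ), ‖f s‖ ≤ C := by
  obtain ⟨C, hC⟩ := isCompact_Icc.exists_bound_of_continuousOn (s := Icc (-τ) (0 : ℝ))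
    hf.continuousOn
  exact ⟨max C 0, le_max_right _ _, fun s hs => (hC s hs).trans (le_max_left _ _)⟩

theorem exists_norm_kernel_le {F : Type*} [NormedAddCommGroup F] (τ a b : ℝ)
    {R : ℝ → ℝ → F} (hR : Continuous (Function.uncurry R)) :
    ∃ C, 0 ≤ C ∧ ∀ s ∈ Icc a b, ∀ θ ∈ Icc (-τ) (0 : ℝ), ‖R s θ‖ ≤ C := by
  obtain ⟨C, hC⟩ := (isCompact_Icc.prod isCompact_Icc).exists_bound_of_continuousOn
    (s := Icc a b ×ˢ Icc (-τ) (0 : ℝ)) hR.continuousOn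
  exact ⟨max C 0, le_max_right _ _, fun s hs θ hθ =>
    (hC (s, θ) ⟨hs, hθ⟩).trans (le_max_left _ _)⟩

theorem Lp.integrable_delay {τ : ℝ} (z : Lp E 2 (delayMeasure τ)) :
    Integrable z (delayMeasure τ) :=
  (Lp.memLp z).integrable (by norm_num)

theorem Continuous.integrable_delay {F : Type*} [NormedAddCommGroup F] {τ : ℝ} {f : ℝ → F}
    (hf : Continuous f) : Integrable f (delayMeasure τ) :=
  hf.continuousOn.integrableOn_compact isCompact_Icc

theorem Continuous.memLp_delay {F : Type*} [NormedAddCommGroup F] {τ : ℝ} {f : ℝ → F}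
    (hf : Continuous f) : MemLp f 2 (delayMeasure τ) := by
  obtain ⟨C, -, hC⟩ := exists_norm_le_of_continuous τ hf
  exact MemLp.of_bound hf.aestronglyMeasurable C ((ae_mem_delayInterval τ).mono hC)

/-- Cauchy–Schwarz against the constant function 1. -/
theorem exists_integral_norm_le (τ : ℝ) : ∃ C, 0 ≤ C ∧ ∀ z : Lp E 2 (delayMeasure τ),
    ∫ s, ‖z s‖ ∂(delayMeasure τ) ≤ C * ‖z‖ := by
  let one : Lp ℝ 2 (delayMeasure τ) := (memLp_const (1 : ℝ)).toLp _
  refine ⟨‖one‖, norm_nonneg _, fun z => ?_⟩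
  have hz : MemLp (fun s => ‖z s‖) 2 (delayMeasure τ) := (Lp.memLp z).norm
  have h : inner ℝ one (hz.toLp _) = ∫ s, ‖z s‖ ∂(delayMeasure τ) := by
    rw [L2.inner_def]
    refine integral_congr_ae ?_
    filter_upwards [MemLp.coeFn_toLp hz, MemLp.coeFn_toLp (memLp_const (μ := delayMeasure τ)
      (p := 2) (1 : ℝ))] with s h1 h2
    rw [h1, h2]; simp
  rw [← h]
  refine (real_inner_le_norm _ _).trans (mul_le_mul_of_nonneg_left (le_of_eq ?_) (norm_nonneg _))
  rw [Lp.norm_toLp, Lp.norm_def, eLpNorm_norm]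

variable [InnerProductSpace ℝ E]

theorem aestronglyMeasurable_clm_apply {τ : ℝ} {f : ℝ → E →L[ℝ] E} (hf : Continuous f)
    {z : ℝ → E} (hz : AEStronglyMeasurable z (delayMeasure τ)) :
    AEStronglyMeasurable (fun s => f s (z s)) (delayMeasure τ) :=
  (ContinuousLinearMap.apply ℝ E (E := E)).flip.aestronglyMeasurable_comp₂
    hf.aestronglyMeasurable hz

theorem integrable_clm_apply {τ : ℝ} {f : ℝ → E →L[ℝ] E} (hf : Continuous f)
    {z : ℝ → E} (hz : Integrable z (delayMeasure τ)) :
    Integrable (fun s => f s (z s)) (delayMeasure τ) := by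
  obtain ⟨C, hC0, hC⟩ := exists_norm_le_of_continuous τ hf
  refine (hz.norm.const_mul C).mono' (aestronglyMeasurable_clm_apply hf hz.1) ?_
  filter_upwards [ae_mem_delayInterval τ] with s hs
  exact (f s).le_of_opNorm_le (hC s hs) _

theorem exists_mulOperator (τ : ℝ) {S : ℝ → E →L[ℝ] E} (hS : Continuous S) :
    ∃ T : Lp E 2 (delayMeasure τ) →L[ℝ] Lp E 2 (delayMeasure τ),
      ∀ z, T z =ᵐ[delayMeasure τ] fun s => S s (z s) := by
  obtain ⟨C, hC0, hC⟩ := exists_norm_le_of_continuous τ hS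
  have hb : ∀ z : ℝ → E, ∀ᵐ s ∂(delayMeasure τ), ‖S s (z s)‖ ≤ C * ‖z s‖ := fun z =>
    (ae_mem_delayInterval τ).mono fun s hs => (S s).le_of_opNorm_le (hC s hs) _
  have hm : ∀ z : Lp E 2 (delayMeasure τ), MemLp (fun s => S s (z s)) 2 (delayMeasure τ) :=
    fun z => (Lp.memLp z).of_le_mul (aestronglyMeasurable_clm_apply hS (Lp.memLp z).1) (hb z)
  let T : Lp E 2 (delayMeasure τ) →ₗ[ℝ] Lp E 2 (delayMeasure τ) :=
    { toFun := fun z => (hm z).toLp _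
      map_add' := fun z w => by
        rw [← MemLp.toLp_add]
        refine MemLp.toLp_congr _ _ ?_
        filter_upwards [Lp.coeFn_add z w] with s hs
        simp only [hs, Pi.add_apply, map_add]
      map_smul' := fun c z => by
        rw [RingHom.id_apply, ← MemLp.toLp_const_smul]
        refine MemLp.toLp_congr _ _ ?_
        filter_upwards [Lp.coeFn_smul c z] with s hs
        simp only [hs, Pi.smul_apply, map_smul] }
  refine ⟨T.mkContinuous C fun z => Lp.norm_le_mul_norm_of_ae_le_mul ?_, fun z =>
    MemLp.coeFn_toLp (hm z)⟩
  filter_upwards [MemLp.coeFn_toLp (hm z), hb z] with s h1 h2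
  rw [show T z s = S s (z s) from h1]
  exact h2

theorem exists_integralOperator (τ : ℝ) {f : ℝ → E →L[ℝ] E} (hf : Continuous f) :
    ∃ T : Lp E 2 (delayMeasure τ) →L[ℝ] E,
      ∀ z, T z = ∫ s, f s (z s) ∂(delayMeasure τ) := by
  obtain ⟨C, hC0, hC⟩ := exists_norm_le_of_continuous τ hf
  obtain ⟨c, hc0, hc⟩ := exists_integral_norm_le (E := E) τ
  have hi := fun z : Lp E 2 (delayMeasure τ) => integrable_clm_apply hf (Lp.integrable_delay z)
  let T : Lp E 2 (delayMeasure τ) →ₗ[ℝ] E :=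
    { toFun := fun z => ∫ s, f s (z s) ∂(delayMeasure τ)
      map_add' := fun z w => by
        rw [← integral_add (hi z) (hi w)]
        refine integral_congr_ae ?_
        filter_upwards [Lp.coeFn_add z w] with s hs
        simp only [hs, Pi.add_apply, map_add]
      map_smul' := fun a z => by
        rw [RingHom.id_apply, ← integral_smul]
        refine integral_congr_ae ?_
        filter_upwards [Lp.coeFn_smul a z] with s hs
        simp only [hs, Pi.smul_apply, map_smul] }
  refine ⟨T.mkContinuous (C * c) fun z => ?_, fun z => rfl⟩
  calc ‖∫ s, f s (z s) ∂(delayMeasure τ)‖ ≤ ∫ s, C * ‖z s‖ ∂(delayMeasure τ) := by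
        refine norm_integral_le_of_norm_le ((Lp.integrable_delay z).norm.const_mul C) ?_
        filter_upwards [ae_mem_delayInterval τ] with s hs
        exact (f s).le_of_opNorm_le (hC s hs) _
    _ ≤ C * c * ‖z‖ := by
        rw [integral_const_mul, mul_assoc]
        exact mul_le_mul_of_nonneg_left (hc z) hC0

/-- Stated for a general domain X because it serves twice: X = E for x ↦ R(·,0)x, and X = L² for the
integral operator with kernel R. -/
theorem exists_functionOperator (τ : ℝ) {X : Type*} [NormedAddCommGroup X] [NormedSpace ℝ X]
    {κ : ℝ → X → E} (hκ : ∀ x, Continuous fun s => κ s x)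
    (hadd : ∀ s x y, κ s (x + y) = κ s x + κ s y) (hsmul : ∀ s (c : ℝ) x, κ s (c • x) = c • κ s x)
    {C : ℝ} (hC0 : 0 ≤ C) (hC : ∀ s ∈ Icc (-τ) (0 : ℝ), ∀ x, ‖κ s x‖ ≤ C * ‖x‖) :
    ∃ T : X →L[ℝ] Lp E 2 (delayMeasure τ), ∀ x, T x =ᵐ[delayMeasure τ] fun s => κ s x := by
  have hm := fun x => (hκ x).memLp_delay (τ := τ)
  let T : X →ₗ[ℝ] Lp E 2 (delayMeasure τ) :=
    { toFun := fun x => (hm x).toLp _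
      map_add' := fun x y => by
        rw [← MemLp.toLp_add]
        exact MemLp.toLp_congr _ _ (Filter.Eventually.of_forall fun s => by simp [hadd])
      map_smul' := fun c x => by
        rw [RingHom.id_apply, ← MemLp.toLp_const_smul]
        exact MemLp.toLp_congr _ _ (Filter.Eventually.of_forall fun s => by simp [hsmul]) }
  refine ⟨T.mkContinuous ((measureUnivNNReal (delayMeasure τ) : ℝ) ^ (2 : ENNReal).toReal⁻¹ * C)
    fun x => ?_, fun x => MemLp.coeFn_toLp (hm x)⟩
  rw [mul_assoc]
  refine Lp.norm_le_of_ae_bound (by positivity) ?_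
  filter_upwards [MemLp.coeFn_toLp (hm x), ae_mem_delayInterval τ] with s h1 h2
  rw [show T x s = κ s x from h1]
  exact hC s h2 x

theorem hasDerivAt_kernel_integral {τ : ℝ} {R R' : ℝ → ℝ → E →L[ℝ] E}
    (hR : Continuous (Function.uncurry R)) (hR' : Continuous (Function.uncurry R'))
    (hd : ∀ s θ, HasDerivAt (fun σ => R σ θ) (R' s θ) s)
    {z : ℝ → E} (hz : Integrable z (delayMeasure τ)) (s : ℝ) :
    HasDerivAt (fun σ => ∫ θ, R σ θ (z θ) ∂(delayMeasure τ))
      (∫ θ, R' s θ (z θ) ∂(delayMeasure τ)) s := by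
  -- A compact window around s bounds R' uniformly, so C‖z‖ dominates the derivatives of the
  -- integrand.
  obtain ⟨C, hC0, hC⟩ := exists_norm_kernel_le τ (s - 1) (s + 1) hR'
  have hs : ∀ {R : ℝ → ℝ → E →L[ℝ] E}, Continuous (Function.uncurry R) → ∀ σ,
      Continuous (R σ) := fun h σ => h.comp (Continuous.prodMk_right σ)
  refine (hasDerivAt_integral_of_dominated_loc_of_deriv_le (bound := fun θ => C * ‖z θ‖)
    (F' := fun σ θ => R' σ θ (z θ))
    (Icc_mem_nhds (a := s - 1) (b := s + 1) (by linarith) (by linarith))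
    (Filter.Eventually.of_forall fun σ => aestronglyMeasurable_clm_apply (hs hR σ) hz.1)
    (integrable_clm_apply (hs hR s) hz) (aestronglyMeasurable_clm_apply (hs hR' s) hz.1)
    ?_ (hz.norm.const_mul C) (Filter.Eventually.of_forall fun θ σ _ => ?_)).2
  · filter_upwards [ae_mem_delayInterval τ] with θ hθ σ hσ
    exact (R' σ θ).le_of_opNorm_le (hC σ hσ θ hθ) _
  · exact (hd σ θ).clm_apply (hasDerivAt_const σ (z θ)) |>.congr_deriv (by simp)

theorem continuous_kernel_integral {τ : ℝ} {R : ℝ → ℝ → E →L[ℝ] E}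
    (hR : Continuous (Function.uncurry R)) {z : ℝ → E} (hz : Integrable z (delayMeasure τ)) :
    Continuous fun s => ∫ θ, R s θ (z θ) ∂(delayMeasure τ) := by
  refine continuous_iff_continuousAt.2 fun s => ?_
  obtain ⟨C, hC0, hC⟩ := exists_norm_kernel_le τ (s - 1) (s + 1) hR
  refine continuousAt_of_dominated (bound := fun θ => C * ‖z θ‖)
    (Filter.Eventually.of_forall fun σ =>
      aestronglyMeasurable_clm_apply (hR.comp (Continuous.prodMk_right σ)) hz.1) ?_
    (hz.norm.const_mul C) (Filter.Eventually.of_forall fun θ => ?_)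
  · filter_upwards [Icc_mem_nhds (show s - 1 < s by linarith) (show s < s + 1 by linarith)]
      with σ hσ
    filter_upwards [ae_mem_delayInterval τ] with θ hθ
    exact (R σ θ).le_of_opNorm_le (hC σ hσ θ hθ) _
  · exact ((hR.comp (Continuous.prodMk_left θ)).clm_apply continuous_const).continuousAt

theorem exists_kernelOperator (τ : ℝ) {R : ℝ → ℝ → E →L[ℝ] E}
    (hR : Continuous (Function.uncurry R)) :
    ∃ T : Lp E 2 (delayMeasure τ) →L[ℝ] Lp E 2 (delayMeasure τ),
      ∀ z, T z =ᵐ[delayMeasure τ] fun s => ∫ θ, R s θ (z θ) ∂(delayMeasure τ) := by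
  obtain ⟨C, hC0, hC⟩ := exists_norm_kernel_le τ (-τ) 0 hR
  obtain ⟨c, hc0, hc⟩ := exists_integral_norm_le (E := E) τ
  have hs : ∀ s, Continuous (R s) := fun s => hR.comp (Continuous.prodMk_right s)
  have hi := fun s (z : Lp E 2 (delayMeasure τ)) =>
    integrable_clm_apply (hs s) (Lp.integrable_delay z)
  refine exists_functionOperator τ (C := C * c)
    (κ := fun s (z : Lp E 2 (delayMeasure τ)) => ∫ θ, R s θ (z θ) ∂(delayMeasure τ))
    (fun z => continuous_kernel_integral hR (Lp.integrable_delay z)) (fun s z w => ?_)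
    (fun s a z => ?_) (by positivity) fun s hs' z => ?_
  · rw [← integral_add (hi s z) (hi s w)]
    refine integral_congr_ae ?_
    filter_upwards [Lp.coeFn_add z w] with θ h
    simp only [h, Pi.add_apply, map_add]
  · rw [← integral_smul]
    refine integral_congr_ae ?_
    filter_upwards [Lp.coeFn_smul a z] with θ h
    simp only [h, Pi.smul_apply, map_smul]
  · calc ‖∫ θ, R s θ (z θ) ∂(delayMeasure τ)‖ ≤ ∫ θ, C * ‖z θ‖ ∂(delayMeasure τ) := by
          refine norm_integral_le_of_norm_le ((Lp.integrable_delay z).norm.const_mul C) ?_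
          filter_upwards [ae_mem_delayInterval τ] with θ hθ
          exact (R s θ).le_of_opNorm_le (hC s hs' θ hθ) _
      _ ≤ C * c * ‖z‖ := by
          rw [integral_const_mul, mul_assoc]
          exact mul_le_mul_of_nonneg_left (hc z) hC0

/-- Fubini. The pair (R, R) gives the self-adjointness of P; the pair (R₁, R₂) of partial
derivatives shows that both have the same quadratic form. -/
theorem integral_inner_kernel_swap {τ : ℝ} [CompleteSpace E] {R T : ℝ → ℝ → E →L[ℝ] E}
    (hR : Continuous (Function.uncurry R)) (hT : Continuous (Function.uncurry T))
    (hRT : ∀ s θ x y, inner ℝ x (R s θ y) = inner ℝ y (T θ s x))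
    {z w : ℝ → E} (hz : Integrable z (delayMeasure τ)) (hw : Integrable w (delayMeasure τ)) :
    ∫ s, inner ℝ (w s) (∫ θ, R s θ (z θ) ∂(delayMeasure τ)) ∂(delayMeasure τ) =
      ∫ s, inner ℝ (z s) (∫ θ, T s θ (w θ) ∂(delayMeasure τ)) ∂(delayMeasure τ) := by
  have h1 : ∀ s, Continuous (R s) := fun s => hR.comp (Continuous.prodMk_right s)
  have h2 : ∀ s, Continuous (T s) := fun s => hT.comp (Continuous.prodMk_right s)
  have e1 : ∀ s, inner ℝ (w s) (∫ θ, R s θ (z θ) ∂(delayMeasure τ)) =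
      ∫ θ, inner ℝ (w s) (R s θ (z θ)) ∂(delayMeasure τ) := fun s =>
    (integral_inner (integrable_clm_apply (h1 s) hz) _).symm
  have e2 : ∀ s, inner ℝ (z s) (∫ θ, T s θ (w θ) ∂(delayMeasure τ)) =
      ∫ θ, inner ℝ (w θ) (R θ s (z s)) ∂(delayMeasure τ) := fun s => by
    rw [← integral_inner (integrable_clm_apply (h2 s) hw)]
    refine integral_congr_ae (Filter.Eventually.of_forall fun θ => ?_)
    exact (hRT θ s (w θ) (z s)).symm
  simp_rw [e1, e2]
  refine integral_integral_swap ?_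
  obtain ⟨C, hC0, hC⟩ := exists_norm_kernel_le τ (-τ) 0 hR
  have hprod := (hw.norm.mul_prod hz.norm).const_mul C
  refine hprod.mono' ?_ ?_
  · have hw' := hw.1.comp_fst (ν := delayMeasure τ)
    have hz' := hz.1.comp_snd (μ := delayMeasure τ)
    exact hw'.inner ((ContinuousLinearMap.apply ℝ E (E := E)).flip.aestronglyMeasurable_comp₂
      hR.aestronglyMeasurable hz')
  · have hmem : ∀ᵐ p ∂((delayMeasure τ).prod (delayMeasure τ)),
        p ∈ Icc (-τ) (0 : ℝ) ×ˢ Icc (-τ) (0 : ℝ) := by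
      rw [Measure.prod_restrict]
      exact ae_restrict_mem (measurableSet_Icc.prod measurableSet_Icc)
    filter_upwards [hmem] with p hp
    calc ‖inner ℝ (w p.1) (R p.1 p.2 (z p.2))‖ ≤ ‖w p.1‖ * (C * ‖z p.2‖) :=
          (norm_inner_le_norm _ _).trans (mul_le_mul_of_nonneg_left
            ((R p.1 p.2).le_of_opNorm_le (hC _ hp.1 _ hp.2) _) (norm_nonneg _))
      _ = C * (‖w p.1‖ * ‖z p.2‖) := by ring

end LtwoOperators

/-! ### The Lyapunov operator -/

section LyapunovOperator

variable {E : Type*} [NormedAddCommGroup E] [InnerProductSpace ℝ E]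

/-- The state space `E × L²[-τ, 0]` of the delay equation. -/
abbrev DelayState (E : Type*) [NormedAddCommGroup E] (τ : ℝ) : Type _ :=
  WithLp 2 (E × Lp E 2 (delayMeasure τ))

/-- Operator-valued data of the dual Lyapunov condition: symmetric continuously differentiable
multiplier `S` and kernel `R`, with `R₁`, `R₂` the partial derivatives of `R`, for which the Lyapunov
form is coercive and dissipative. -/
structure IsDualCertificate (τ ε : ℝ) (A₀ A₁ : E →L[ℝ] E) (S S' : ℝ → E →L[ℝ] E)
    (R R₁ R₂ : ℝ → ℝ → E →L[ℝ] E) : Prop where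
  hasDerivAt_S : ∀ s, HasDerivAt S (S' s) s
  continuous_S' : Continuous S'
  continuous_R : Continuous (Function.uncurry R)
  continuous_R₁ : Continuous (Function.uncurry R₁)
  continuous_R₂ : Continuous (Function.uncurry R₂)
  hasDerivAt_R : ∀ s θ, HasDerivAt (fun σ => R σ θ) (R₁ s θ) s
  symm_S : ∀ s x y, inner ℝ x (S s y) = inner ℝ y (S s x)
  symm_R : ∀ s θ x y, inner ℝ x (R s θ y) = inner ℝ y (R θ s x)
  symm_R₁ : ∀ s θ x y, inner ℝ x (R₁ s θ y) = inner ℝ y (R₂ θ s x)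
  le_S : ∀ s ∈ Icc (-τ) (0 : ℝ), ∀ x, ε * ‖x‖ ^ 2 ≤ τ * inner ℝ x (S s x)
  coercive : ∀ (x : E) (z : ℝ → E), Continuous z →
    0 ≤ (∫ s, (inner ℝ x (τ • (R 0 0 x + S 0 x)) + inner ℝ x (τ • R 0 s (z s))
        + inner ℝ (z s) (τ • R s 0 x) + inner ℝ (z s) (τ • S s (z s))
        - ε * (‖x‖ ^ 2 + ‖z s‖ ^ 2)) ∂(delayMeasure τ))
      + ∫ s, inner ℝ (z s) (∫ θ, R s θ (z θ) ∂(delayMeasure τ)) ∂(delayMeasure τ)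
  dissipative : ∀ (x u : E) (z : ℝ → E), Continuous z →
    (∫ s, (2 * inner ℝ x (τ • A₀ (R 0 0 x + S 0 x) + τ • A₁ (R (-τ) 0 x) + (1 / 2 : ℝ) • S 0 x)
        + 2 * inner ℝ x (τ • A₁ (S (-τ) u)) - inner ℝ u (S (-τ) u)
        + 2 * inner ℝ x (τ • (A₀ (R 0 s (z s)) + A₁ (R (-τ) s (z s)) + R₂ 0 s (z s)))
        + τ * inner ℝ (z s) (S' s (z s)) + ε * (‖x‖ ^ 2 + ‖z s‖ ^ 2)) ∂(delayMeasure τ))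
      + ∫ s, inner ℝ (z s) (∫ θ, (R₁ s θ + R₂ s θ) (z θ) ∂(delayMeasure τ)) ∂(delayMeasure τ) ≤ 0

namespace IsDualCertificate

variable {τ ε : ℝ} {A₀ A₁ : E →L[ℝ] E} {S S' : ℝ → E →L[ℝ] E} {R R₁ R₂ : ℝ → ℝ → E →L[ℝ] E}

theorem continuous_S (h : IsDualCertificate τ ε A₀ A₁ S S' R R₁ R₂) : Continuous S :=
  continuous_iff_continuousAt.2 fun s => (h.hasDerivAt_S s).continuousAt

theorem continuous_R_right (h : IsDualCertificate τ ε A₀ A₁ S S' R R₁ R₂) (s : ℝ) :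
    Continuous (R s) := h.continuous_R.comp (Continuous.prodMk_right s)

theorem continuous_R_left (h : IsDualCertificate τ ε A₀ A₁ S S' R R₁ R₂) (θ : ℝ) :
    Continuous fun s => R s θ := h.continuous_R.comp (Continuous.prodMk_left θ)

/-- The extra factor τ in the first component has two purposes: it makes P symmetric for the
unweighted inner product, and it gives P(x,z) = (τf(0), f) whenever z is continuous with z(0) = x.
-/
theorem exists_operator (h : IsDualCertificate τ ε A₀ A₁ S S' R R₁ R₂) :
    ∃ P : DelayState E τ →L[ℝ] DelayState E τ,
      (∀ y, (P y).ofLp.1 = τ • (τ • (R 0 0 y.ofLp.1 + S 0 y.ofLp.1)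
        + ∫ s, R 0 s (y.ofLp.2 s) ∂(delayMeasure τ))) ∧
      ∀ y, (P y).ofLp.2 =ᵐ[delayMeasure τ] fun s => τ • R s 0 y.ofLp.1 + τ • S s (y.ofLp.2 s)
        + ∫ θ, R s θ (y.ofLp.2 θ) ∂(delayMeasure τ) := by
  obtain ⟨J, hJ⟩ := exists_integralOperator τ (h.continuous_R_right 0)
  obtain ⟨m, hm⟩ := exists_mulOperator τ h.continuous_S
  obtain ⟨k, hk⟩ := exists_kernelOperator τ h.continuous_R
  obtain ⟨C, hC0, hC⟩ := exists_norm_le_of_continuous τ (h.continuous_R_left 0)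
  obtain ⟨f, hf⟩ := exists_functionOperator τ (κ := fun s x => R s 0 x)
    (fun x => (h.continuous_R_left 0).clm_apply continuous_const) (fun s x y => map_add _ x y)
    (fun s c x => map_smul _ c x) hC0 (fun s hs x => (R s 0).le_of_opNorm_le (hC s hs) x)
  let e := WithLp.prodContinuousLinearEquiv 2 ℝ E (Lp E 2 (delayMeasure τ))
  let p₁ : E × Lp E 2 (delayMeasure τ) →L[ℝ] E :=
    τ • (τ • (R 0 0 + S 0).comp (ContinuousLinearMap.fst ℝ _ _)
      + J.comp (ContinuousLinearMap.snd ℝ _ _))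
  let p₂ : E × Lp E 2 (delayMeasure τ) →L[ℝ] Lp E 2 (delayMeasure τ) :=
    τ • f.comp (ContinuousLinearMap.fst ℝ _ _) + (τ • m + k).comp (ContinuousLinearMap.snd ℝ _ _)
  refine ⟨(e.symm : _ →L[ℝ] _).comp ((p₁.prod p₂).comp (e : _ →L[ℝ] _)), fun y => ?_, fun y => ?_⟩
  · change τ • (τ • (R 0 0 + S 0) y.ofLp.1 + J y.ofLp.2) = _
    rw [hJ, _root_.add_apply]
  · change ((τ • f y.ofLp.1 + (τ • m y.ofLp.2 + k y.ofLp.2) : Lp E 2 (delayMeasure τ)) : ℝ → E)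
      =ᵐ[delayMeasure τ] _
    filter_upwards [hm y.ofLp.2, hk y.ofLp.2, hf y.ofLp.1, Lp.coeFn_smul τ (f y.ofLp.1),
      Lp.coeFn_smul τ (m y.ofLp.2), Lp.coeFn_add (τ • m y.ofLp.2) (k y.ofLp.2),
      Lp.coeFn_add (τ • f y.ofLp.1) (τ • m y.ofLp.2 + k y.ofLp.2)] with s h1 h2 h3 h4 h5 h6 h7
    rw [h7, Pi.add_apply, h6, Pi.add_apply, h5, h4, Pi.smul_apply, Pi.smul_apply, h1, h2, h3,
      add_assoc]

theorem integrable_inner_kernel {z w : Lp E 2 (delayMeasure τ)}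
    (h : IsDualCertificate τ ε A₀ A₁ S S' R R₁ R₂) :
    Integrable (fun s => inner ℝ (w s) (∫ θ, R s θ (z θ) ∂(delayMeasure τ)))
      (delayMeasure τ) := by
  obtain ⟨k, hk⟩ := exists_kernelOperator τ h.continuous_R
  refine (L2.integrable_inner (𝕜 := ℝ) w (k z)).congr ?_
  filter_upwards [hk z] with s hs
  rw [hs]

theorem integrable_inner_mul {z w : Lp E 2 (delayMeasure τ)}
    (h : IsDualCertificate τ ε A₀ A₁ S S' R R₁ R₂) :
    Integrable (fun s => inner ℝ (w s) (S s (z s))) (delayMeasure τ) := by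
  obtain ⟨k, hk⟩ := exists_mulOperator τ h.continuous_S
  refine (L2.integrable_inner (𝕜 := ℝ) w (k z)).congr ?_
  filter_upwards [hk z] with s hs
  rw [hs]

variable [CompleteSpace E]

/-- The expansion is arranged so that exchanging w and y swaps the second and third terms and fixes
the others, while w = y yields the form in `coercive`. -/
theorem inner_operator (h : IsDualCertificate τ ε A₀ A₁ S S' R R₁ R₂)
    {P : DelayState E τ →L[ℝ] DelayState E τ}
    (hP₁ : ∀ y, (P y).ofLp.1 = τ • (τ • (R 0 0 y.ofLp.1 + S 0 y.ofLp.1)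
        + ∫ s, R 0 s (y.ofLp.2 s) ∂(delayMeasure τ)))
    (hP₂ : ∀ y, (P y).ofLp.2 =ᵐ[delayMeasure τ] fun s => τ • R s 0 y.ofLp.1
        + τ • S s (y.ofLp.2 s) + ∫ θ, R s θ (y.ofLp.2 θ) ∂(delayMeasure τ))
    (w y : DelayState E τ) :
    inner ℝ w (P y) = τ * inner ℝ w.ofLp.1 (τ • (R 0 0 y.ofLp.1 + S 0 y.ofLp.1))
      + (∫ s, inner ℝ w.ofLp.1 (τ • R 0 s (y.ofLp.2 s)) ∂(delayMeasure τ))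
      + (∫ s, inner ℝ y.ofLp.1 (τ • R 0 s (w.ofLp.2 s)) ∂(delayMeasure τ))
      + (∫ s, inner ℝ (w.ofLp.2 s) (τ • S s (y.ofLp.2 s)) ∂(delayMeasure τ))
      + ∫ s, inner ℝ (w.ofLp.2 s) (∫ θ, R s θ (y.ofLp.2 θ) ∂(delayMeasure τ))
        ∂(delayMeasure τ) := by
  have hi : ∀ z : Lp E 2 (delayMeasure τ), ∀ x : E,
      Integrable (fun s => inner ℝ x (τ • R 0 s (z s))) (delayMeasure τ) := fun z x =>
    ((integrable_clm_apply (h.continuous_R_right 0) (Lp.integrable_delay z)).smul τ).const_inner x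
  have h2 : inner ℝ w.ofLp.2 (P y).ofLp.2 =
      ∫ s, (inner ℝ y.ofLp.1 (τ • R 0 s (w.ofLp.2 s))
        + inner ℝ (w.ofLp.2 s) (τ • S s (y.ofLp.2 s))
        + inner ℝ (w.ofLp.2 s) (∫ θ, R s θ (y.ofLp.2 θ) ∂(delayMeasure τ)))
        ∂(delayMeasure τ) := by
    rw [L2.inner_def]
    refine integral_congr_ae ?_
    filter_upwards [hP₂ y] with s hs
    rw [hs, inner_add_right, inner_add_right, real_inner_smul_right, h.symm_R,
      ← real_inner_smul_right]
  have hS : Integrable (fun s => inner ℝ (w.ofLp.2 s) (τ • S s (y.ofLp.2 s)))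
      (delayMeasure τ) := by
    simp_rw [real_inner_smul_right]
    exact h.integrable_inner_mul.const_mul τ
  have hsum : Integrable (fun s => inner ℝ y.ofLp.1 (τ • R 0 s (w.ofLp.2 s))
      + inner ℝ (w.ofLp.2 s) (τ • S s (y.ofLp.2 s))) (delayMeasure τ) := (hi _ _).add hS
  rw [WithLp.prod_inner_apply, h2, hP₁, integral_add hsum h.integrable_inner_kernel,
    integral_add (hi _ _) hS, real_inner_smul_right, inner_add_right,
    ← integral_inner (integrable_clm_apply (h.continuous_R_right 0) (Lp.integrable_delay _)),
    mul_add, ← integral_const_mul]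
  simp_rw [real_inner_smul_right]
  ring

theorem inner_operator_comm (h : IsDualCertificate τ ε A₀ A₁ S S' R R₁ R₂)
    {P : DelayState E τ →L[ℝ] DelayState E τ}
    (hP₁ : ∀ y, (P y).ofLp.1 = τ • (τ • (R 0 0 y.ofLp.1 + S 0 y.ofLp.1)
        + ∫ s, R 0 s (y.ofLp.2 s) ∂(delayMeasure τ)))
    (hP₂ : ∀ y, (P y).ofLp.2 =ᵐ[delayMeasure τ] fun s => τ • R s 0 y.ofLp.1
        + τ • S s (y.ofLp.2 s) + ∫ θ, R s θ (y.ofLp.2 θ) ∂(delayMeasure τ))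
    (w y : DelayState E τ) : inner ℝ w (P y) = inner ℝ y (P w) := by
  rw [h.inner_operator hP₁ hP₂, h.inner_operator hP₁ hP₂,
    integral_inner_kernel_swap h.continuous_R h.continuous_R h.symm_R (Lp.integrable_delay _)
      (Lp.integrable_delay _)]
  simp_rw [real_inner_smul_right, inner_add_right, h.symm_S _ (w.ofLp.2 _) (y.ofLp.2 _),
    h.symm_S _ w.ofLp.1 y.ofLp.1, h.symm_R _ _ w.ofLp.1 y.ofLp.1]
  ring

/-- `coercive` speaks of continuous z only; both sides depend continuously on the L² component, so
density of bounded continuous functions suffices. Integrating ε‖x‖² over the interval produces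
ετ‖x‖², hence the constant with min(τ, 1). -/
theorem le_inner_operator (h : IsDualCertificate τ ε A₀ A₁ S S' R R₁ R₂) (hτ : 0 < τ)
    (hε : 0 < ε) {P : DelayState E τ →L[ℝ] DelayState E τ}
    (hP₁ : ∀ y, (P y).ofLp.1 = τ • (τ • (R 0 0 y.ofLp.1 + S 0 y.ofLp.1)
        + ∫ s, R 0 s (y.ofLp.2 s) ∂(delayMeasure τ)))
    (hP₂ : ∀ y, (P y).ofLp.2 =ᵐ[delayMeasure τ] fun s => τ • R s 0 y.ofLp.1
        + τ • S s (y.ofLp.2 s) + ∫ θ, R s θ (y.ofLp.2 θ) ∂(delayMeasure τ))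
    (y : DelayState E τ) : ε * min τ 1 * ‖y‖ ^ 2 ≤ inner ℝ y (P y) := by
  obtain ⟨x, f, rfl⟩ : ∃ x f, y = WithLp.toLp 2 (x, f) := ⟨y.ofLp.1, y.ofLp.2, rfl⟩
  have hcont : Continuous fun f : Lp E 2 (delayMeasure τ) =>
      (WithLp.toLp 2 (x, f) : DelayState E τ) :=
    (WithLp.prod_continuous_toLp 2 _ _).comp (Continuous.prodMk_right x)
  refine (BoundedContinuousFunction.toLp_denseRange E (delayMeasure τ) ℝ
    (p := 2) (by norm_num)).induction_on
    (p := fun f => ε * min τ 1 * ‖(WithLp.toLp 2 (x, f) : DelayState E τ)‖ ^ 2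
      ≤ inner ℝ (WithLp.toLp 2 (x, f) : DelayState E τ) (P (WithLp.toLp 2 (x, f)))) f
    (isClosed_le (by fun_prop) (by fun_prop)) fun z => ?_
  have hz : BoundedContinuousFunction.toLp 2 (delayMeasure τ) ℝ z =ᵐ[delayMeasure τ] z :=
    BoundedContinuousFunction.coeFn_toLp 2 _ ℝ z
  have hzc : Continuous z := z.continuous
  set g := BoundedContinuousFunction.toLp 2 (delayMeasure τ) ℝ z with hg
  have hker : ∀ s, ∫ θ, R s θ (g θ) ∂(delayMeasure τ) = ∫ θ, R s θ (z θ) ∂(delayMeasure τ) :=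
    fun s => integral_congr_ae (hz.mono fun θ hθ => by simp only [hθ])
  have e1 : ∫ s, inner ℝ x (τ • R 0 s (g s)) ∂(delayMeasure τ)
      = ∫ s, inner ℝ x (τ • R 0 s (z s)) ∂(delayMeasure τ) :=
    integral_congr_ae (hz.mono fun θ hθ => by simp only [hθ])
  have e2 : ∫ s, inner ℝ (g s) (τ • S s (g s)) ∂(delayMeasure τ)
      = ∫ s, inner ℝ (z s) (τ • S s (z s)) ∂(delayMeasure τ) :=
    integral_congr_ae (hz.mono fun θ hθ => by simp only [hθ])
  have e3 : ∫ s, inner ℝ (g s) (∫ θ, R s θ (g θ) ∂(delayMeasure τ)) ∂(delayMeasure τ)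
      = ∫ s, inner ℝ (z s) (∫ θ, R s θ (z θ) ∂(delayMeasure τ)) ∂(delayMeasure τ) :=
    integral_congr_ae (hz.mono fun θ hθ => by simp only [hθ, hker])
  have e4 : ‖(WithLp.toLp 2 (x, g) : DelayState E τ)‖ ^ 2
      = ‖x‖ ^ 2 + ∫ s, ‖z s‖ ^ 2 ∂(delayMeasure τ) := by
    rw [← real_inner_self_eq_norm_sq, WithLp.prod_inner_apply, real_inner_self_eq_norm_sq,
      L2.inner_def]
    congr 1
    exact integral_congr_ae (hz.mono fun θ hθ => by simp only [hθ, real_inner_self_eq_norm_sq])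
  have c0 := h.continuous_R_right 0
  have c1 := h.continuous_R_left 0
  have cS := h.continuous_S
  have hpos := h.coercive x z hzc
  rw [integral_sub (Continuous.integrable_delay (by fun_prop))
    (Continuous.integrable_delay (by fun_prop)),
    integral_add (Continuous.integrable_delay (by fun_prop))
    (Continuous.integrable_delay (by fun_prop)),
    integral_add (Continuous.integrable_delay (by fun_prop))
    (Continuous.integrable_delay (by fun_prop)),
    integral_add (Continuous.integrable_delay (by fun_prop))
    (Continuous.integrable_delay (by fun_prop)),
    integral_const_mul, integral_add (Continuous.integrable_delay (by fun_prop))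
    (Continuous.integrable_delay (by fun_prop)), integral_const, integral_const,
    measureReal_delay hτ.le, smul_eq_mul, smul_eq_mul] at hpos
  have e5 : ∫ s, inner ℝ (z s) (τ • R s 0 x) ∂(delayMeasure τ)
      = ∫ s, inner ℝ x (τ • R 0 s (z s)) ∂(delayMeasure τ) := by
    congr 1; ext s
    rw [real_inner_smul_right, real_inner_smul_right, h.symm_R]
  rw [h.inner_operator hP₁ hP₂, e4]
  simp only
  rw [e1, e2, e3]
  rw [e5] at hpos
  have hx : min τ 1 * ‖x‖ ^ 2 ≤ τ * ‖x‖ ^ 2 :=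
    mul_le_mul_of_nonneg_right (min_le_left _ _) (by positivity)
  have hI : 0 ≤ ∫ s, ‖z s‖ ^ 2 ∂(delayMeasure τ) := integral_nonneg fun s => by positivity
  have hz1 : min τ 1 * ∫ s, ‖z s‖ ^ 2 ∂(delayMeasure τ) ≤ ∫ s, ‖z s‖ ^ 2 ∂(delayMeasure τ) := by
    nlinarith [min_le_right τ 1]
  have := mul_le_mul_of_nonneg_left (add_le_add hx hz1) hε.le
  linarith

end IsDualCertificate

end LyapunovOperator

/-! ### Dissipation along solutions -/

namespace IsDualCertificate

variable {E : Type*} [NormedAddCommGroup E] [InnerProductSpace ℝ E]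
  {τ ε : ℝ} {A₀ A₁ : E →L[ℝ] E} {S S' : ℝ → E →L[ℝ] E} {R R₁ R₂ : ℝ → ℝ → E →L[ℝ] E}

/-- The fundamental theorem of calculus for ⟨w, Sw⟩; symmetry of S merges the two terms containing
w'. -/
theorem integral_inner_S_deriv (h : IsDualCertificate τ ε A₀ A₁ S S' R R₁ R₂) (hτ : 0 ≤ τ)
    {w w' : ℝ → E} (hw : Continuous w) (hw' : ContinuousOn w' (Icc (-τ) 0))
    (hd : ∀ s ∈ Ioo (-τ) 0, HasDerivAt w (w' s) s) :
    (∫ s, inner ℝ (w s) (S' s (w s)) ∂(delayMeasure τ))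
      + 2 * ∫ s, inner ℝ (w s) (S s (w' s)) ∂(delayMeasure τ)
      = inner ℝ (w 0) (S 0 (w 0)) - inner ℝ (w (-τ)) (S (-τ) (w (-τ))) := by
  have cS := h.continuous_S
  have cS' := h.continuous_S'
  have i2 : Integrable (fun s => 2 * inner ℝ (w s) (S s (w' s))) (delayMeasure τ) :=
    (continuousOn_const.mul (hw.continuousOn.inner
      (cS.continuousOn.clm_apply hw'))).integrableOn_compact isCompact_Icc
  have i1 : Integrable (fun s => inner ℝ (w s) (S' s (w s))) (delayMeasure τ) :=
    Continuous.integrable_delay (by fun_prop)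
  have key := intervalIntegral.integral_eq_sub_of_hasDerivAt_of_le (neg_nonpos.2 hτ)
    (f := fun s => inner ℝ (w s) (S s (w s)))
    (f' := fun s => inner ℝ (w s) (S' s (w s)) + 2 * inner ℝ (w s) (S s (w' s)))
    (by fun_prop) (fun s hs => ?_) ?_
  · rw [← integral_const_mul, ← integral_add i1 i2, ← key, intervalIntegral.integral_of_le
      (neg_nonpos.2 hτ), integral_Icc_eq_integral_Ioc]
  · refine ((hd s hs).inner ℝ ((h.hasDerivAt_S s).clm_apply (hd s hs))).congr_deriv ?_
    rw [inner_add_right, real_inner_comm, h.symm_S s (w s) (w' s), real_inner_comm]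
    ring
  · rw [intervalIntegrable_iff_integrableOn_Icc_of_le (neg_nonpos.2 hτ)]
    exact i1.add i2

variable [CompleteSpace E]

/-- Lax–Milgram, from the pointwise bound τS(s) ≥ ε. -/
theorem isUnit_smul_S (h : IsDualCertificate τ ε A₀ A₁ S S' R R₁ R₂) (hε : 0 < ε)
    {s : ℝ} (hs : s ∈ Icc (-τ) (0 : ℝ)) : IsUnit (τ • S s) := by
  refine ContinuousLinearMap.isUnit_of_forall_le_norm_inner_map (τ • S s) (c := ⟨ε, hε.le⟩) hε
    fun x => ?_
  have := h.le_S s hs x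
  rw [_root_.smul_apply, real_inner_smul_left, real_inner_comm]
  calc ‖x‖ ^ 2 * ε = ε * ‖x‖ ^ 2 := mul_comm _ _
    _ ≤ _ := this.trans (Real.le_norm_self _)

/-- If `P k = (τ f(0), f)` with `f` continuously differentiable, then the function component of `k`
has a continuously differentiable representative whose value at `0` is the vector component. -/
theorem exists_representative (h : IsDualCertificate τ ε A₀ A₁ S S' R R₁ R₂) (hτ : 0 < τ)
    (hε : 0 < ε) {x : E} {z : Lp E 2 (delayMeasure τ)} {f f' : ℝ → E}
    (hf : ∀ s, HasDerivAt f (f' s) s) (hf' : Continuous f')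
    (h₀ : τ • (R 0 0 x + S 0 x) + ∫ s, R 0 s (z s) ∂(delayMeasure τ) = f 0)
    (hz : (fun s => τ • R s 0 x + τ • S s (z s) + ∫ θ, R s θ (z θ) ∂(delayMeasure τ))
      =ᵐ[delayMeasure τ] f) :
    ∃ w w' : ℝ → E, Continuous w ∧ ContinuousOn w' (Icc (-τ) 0) ∧
      (∀ s ∈ Ioo (-τ) 0, HasDerivAt w (w' s) s) ∧ z =ᵐ[delayMeasure τ] w ∧ w 0 = x ∧
      ∀ s ∈ Icc (-τ) 0, f s =
        τ • R s 0 x + τ • S s (w s) + ∫ θ, R s θ (w θ) ∂(delayMeasure τ) := by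
  have hzi := Lp.integrable_delay z
  -- Solving the identity for its multiplier term gives τSz = b almost everywhere. Although z is
  -- only in L², b is C¹, because the kernel integral is as smooth in s as R.
  let b : ℝ → E := fun s => f s - τ • R s 0 x - ∫ θ, R s θ (z θ) ∂(delayMeasure τ)
  let b' : ℝ → E := fun s => f' s - τ • R₁ s 0 x - ∫ θ, R₁ s θ (z θ) ∂(delayMeasure τ)
  have hb : ∀ s, HasDerivAt b (b' s) s := fun s => by
    have h1 : HasDerivAt (fun s => R s 0 x) (R₁ s 0 x) s := by
      simpa using (h.hasDerivAt_R s 0).clm_apply (hasDerivAt_const s x)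
    exact ((hf s).sub (h1.const_smul τ)).sub
      (hasDerivAt_kernel_integral h.continuous_R h.continuous_R₁ h.hasDerivAt_R hzi s)
  have hb' : Continuous b' := by
    have h1 : Continuous fun s => R₁ s 0 := h.continuous_R₁.comp (Continuous.prodMk_left 0)
    exact (hf'.sub ((h1.clm_apply continuous_const).const_smul τ)).sub
      (continuous_kernel_integral h.continuous_R₁ hzi)
  have hbc : Continuous b := continuous_iff_continuousAt.2 fun s => (hb s).continuousAt
  let T : ℝ → E →L[ℝ] E := fun s => Ring.inverse (τ • S s)
  let T' : ℝ → E →L[ℝ] E := fun s => -(T s * (τ • S' s) * T s)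
  have hT : ∀ s ∈ Icc (-τ) 0, HasDerivAt T (T' s) s := fun s hs => by
    obtain ⟨u, hu⟩ := h.isUnit_smul_S hε hs
    have h1 : HasFDerivAt Ring.inverse
        (-((ContinuousLinearMap.mulLeftRight ℝ (E →L[ℝ] E)) ↑u⁻¹) ↑u⁻¹) (τ • S s) :=
      hu ▸ hasFDerivAt_ringInverse u
    refine (h1.comp_hasDerivAt s ((h.hasDerivAt_S s).const_smul τ)).congr_deriv ?_
    simp only [T', T, ← hu, Ring.inverse_unit]
    simp
  have hTc : ContinuousOn T (Icc (-τ) 0) := fun s hs => (hT s hs).continuousAt.continuousWithinAt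
  have hTS : ∀ s ∈ Icc (-τ) 0, ∀ y, T s (τ • S s y) = y := fun s hs y =>
    congrArg (fun L : E →L[ℝ] E => L y) (Ring.inverse_mul_cancel _ (h.isUnit_smul_S hε hs))
  have hST : ∀ s ∈ Icc (-τ) 0, ∀ y, τ • S s (T s y) = y := fun s hs y =>
    congrArg (fun L : E →L[ℝ] E => L y) (Ring.mul_inverse_cancel _ (h.isUnit_smul_S hε hs))
  let ζ : ℝ → E := fun s => T s (b s)
  -- τS is known to be invertible only on the interval. Extending ζ by its end values gives a
  -- function continuous on the whole line, as the quadratic forms require.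
  let w : ℝ → E := IccExtend (neg_nonpos.2 hτ.le) ((Icc (-τ) 0).domRestrict ζ)
  have hwζ : ∀ s ∈ Icc (-τ) 0, w s = ζ s := fun s hs => IccExtend_of_mem _ _ hs
  have hzw : z =ᵐ[delayMeasure τ] w := by
    filter_upwards [hz, ae_mem_delayInterval τ] with s hs hsI
    rw [hwζ s hsI, ← hTS s hsI (z s)]
    simp only [ζ, b]
    rw [← hs]
    congr 1
    abel
  have hker : ∀ s, ∫ θ, R s θ (z θ) ∂(delayMeasure τ) = ∫ θ, R s θ (w θ) ∂(delayMeasure τ) :=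
    fun s => integral_congr_ae (hzw.mono fun θ hθ => by simp only [hθ])
  refine ⟨w, fun s => T' s (b s) + T s (b' s), ?_, ?_, fun s hs => ?_, hzw, ?_, fun s hs => ?_⟩
  · exact (continuousOn_iff_continuous_domRestrict.1 (hTc.clm_apply hbc.continuousOn)).Icc_extend'
  · have hS' := h.continuous_S'
    have hT'c : ContinuousOn T' (Icc (-τ) 0) :=
      ((hTc.mul (hS'.const_smul τ).continuousOn).mul hTc).neg
    exact (hT'c.clm_apply hbc.continuousOn).add (hTc.clm_apply hb'.continuousOn)
  · refine ((hT s (Ioo_subset_Icc_self hs)).clm_apply (hb s)).congr_of_eventuallyEq ?_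
    filter_upwards [Icc_mem_nhds hs.1 hs.2] with σ hσ using hwζ σ hσ
  -- By `h₀`, b(0) = τS(0)x: this is where the first component of P is matched to the second at s =
  -- 0.
  · have h0 : (0 : ℝ) ∈ Icc (-τ) 0 := ⟨by linarith, le_rfl⟩
    refine (hwζ 0 h0).trans ?_
    simp only [ζ, b]
    rw [← h₀, smul_add]
    convert hTS 0 h0 x using 2
    abel
  · rw [hwζ s hs, ← hker]
    simp only [ζ]
    rw [hST s hs]
    simp only [b]
    abel

/-- Here f is the solution segment and (x, z) is the preimage of (τf(0), f) under P, so the left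
side is the derivative of V. It is computed entirely through the representative w of z and compared
with the form in `dissipative`. -/
theorem inner_deriv_le (h : IsDualCertificate τ ε A₀ A₁ S S' R R₁ R₂) (hτ : 0 < τ)
    (hε : 0 < ε) {x : E} {z : Lp E 2 (delayMeasure τ)} {f f' : ℝ → E}
    (hf : ∀ s, HasDerivAt f (f' s) s) (hf' : Continuous f')
    (h₀ : τ • (R 0 0 x + S 0 x) + ∫ s, R 0 s (z s) ∂(delayMeasure τ) = f 0)
    (hz : (fun s => τ • R s 0 x + τ • S s (z s) + ∫ θ, R s θ (z θ) ∂(delayMeasure τ))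
      =ᵐ[delayMeasure τ] f)
    (hA : f' 0 = A₀ (f 0) + A₁ (f (-τ))) :
    2 * (τ * inner ℝ x (f' 0) + ∫ s, inner ℝ (z s) (f' s) ∂(delayMeasure τ))
      ≤ -(ε * (τ * ‖x‖ ^ 2 + ∫ s, ‖z s‖ ^ 2 ∂(delayMeasure τ))) := by
  obtain ⟨w, w', hw, hw', hd, hzw, hw0, hfw⟩ := h.exists_representative hτ hε hf hf' h₀ hz
  have cS := h.continuous_S
  have cS' := h.continuous_S'
  have cR0 := h.continuous_R_right 0
  have cRτ := h.continuous_R_right (-τ)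
  have cR₁0 : Continuous fun s => R₁ s 0 := h.continuous_R₁.comp (Continuous.prodMk_left 0)
  have cR₁s : ∀ s, Continuous (R₁ s) := fun s => h.continuous_R₁.comp (Continuous.prodMk_right s)
  have cR₂s : ∀ s, Continuous (R₂ s) := fun s => h.continuous_R₂.comp (Continuous.prodMk_right s)
  have hwi : Integrable w (delayMeasure τ) := hw.integrable_delay
  have cK₁ : Continuous fun s => ∫ θ, R₁ s θ (w θ) ∂(delayMeasure τ) :=
    continuous_kernel_integral h.continuous_R₁ hwi
  have cK₂ : Continuous fun s => ∫ θ, R₂ s θ (w θ) ∂(delayMeasure τ) :=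
    continuous_kernel_integral h.continuous_R₂ hwi
  -- The formula for f through w is available on the interval only, so it is differentiated in the
  -- interior.
  have hf's : ∀ s ∈ Ioo (-τ) 0, f' s = τ • R₁ s 0 x + τ • (S' s (w s) + S s (w' s))
      + ∫ θ, R₁ s θ (w θ) ∂(delayMeasure τ) := fun s hs => by
    refine (hf s).unique (HasDerivAt.congr_of_eventuallyEq (((HasDerivAt.const_smul τ ?_).add
      (((h.hasDerivAt_S s).clm_apply (hd s hs)).const_smul τ)).add
      (hasDerivAt_kernel_integral h.continuous_R h.continuous_R₁ h.hasDerivAt_R hwi s))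
      (f := fun s => τ • R s 0 x + τ • S s (w s) + ∫ θ, R s θ (w θ) ∂(delayMeasure τ)) ?_)
    · simpa using (h.hasDerivAt_R s 0).clm_apply (hasDerivAt_const s x)
    · filter_upwards [Icc_mem_nhds hs.1 hs.2] with σ hσ using hfw σ hσ
  have iSw' : Integrable (fun s => inner ℝ (w s) (S s (w' s))) (delayMeasure τ) :=
    (hw.continuousOn.inner
      (cS.continuousOn.clm_apply hw')).integrableOn_compact isCompact_Icc
  have i1 : Integrable (fun s => inner ℝ x (R₂ 0 s (w s))) (delayMeasure τ) :=
    Continuous.integrable_delay (by have := cR₂s 0; fun_prop)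
  have i2 : Integrable (fun s => inner ℝ (w s) (S' s (w s))) (delayMeasure τ) :=
    Continuous.integrable_delay (by fun_prop)
  have i3 : Integrable (fun s => inner ℝ (w s) (∫ θ, R₁ s θ (w θ) ∂(delayMeasure τ)))
    (delayMeasure τ) := Continuous.integrable_delay (by fun_prop)
  have i4 : Integrable (fun s => inner ℝ (w s) (∫ θ, R₂ s θ (w θ) ∂(delayMeasure τ)))
    (delayMeasure τ) := Continuous.integrable_delay (by fun_prop)
  have i5 : Integrable (fun s => inner ℝ x (A₀ (R 0 s (w s)))) (delayMeasure τ) :=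
    Continuous.integrable_delay (by fun_prop)
  have i6 : Integrable (fun s => inner ℝ x (A₁ (R (-τ) s (w s)))) (delayMeasure τ) :=
    Continuous.integrable_delay (by fun_prop)
  have i7 : Integrable (fun s => ‖w s‖ ^ 2) (delayMeasure τ) :=
    Continuous.integrable_delay (by fun_prop)
  have ic : ∀ c : ℝ, Integrable (fun _ => c) (delayMeasure τ) := fun c => integrable_const c
  have hIoo : ∀ᵐ s ∂(delayMeasure τ), s ∈ Ioo (-τ) (0 : ℝ) := by
    rw [delayMeasure, ← restrict_Ioo_eq_restrict_Icc]
    exact ae_restrict_mem measurableSet_Ioo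
  have e1 : ∫ s, inner ℝ (z s) (f' s) ∂(delayMeasure τ)
      = τ * (∫ s, inner ℝ x (R₂ 0 s (w s)) ∂(delayMeasure τ))
        + τ * (∫ s, inner ℝ (w s) (S' s (w s)) ∂(delayMeasure τ))
        + τ * (∫ s, inner ℝ (w s) (S s (w' s)) ∂(delayMeasure τ))
        + ∫ s, inner ℝ (w s) (∫ θ, R₁ s θ (w θ) ∂(delayMeasure τ)) ∂(delayMeasure τ) := by
    rw [← integral_const_mul, ← integral_const_mul, ← integral_const_mul,
      ← integral_add' (i1.const_mul τ) (i2.const_mul τ),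
      ← integral_add' ((i1.const_mul τ).add (i2.const_mul τ)) (iSw'.const_mul τ),
      ← integral_add' (((i1.const_mul τ).add (i2.const_mul τ)).add (iSw'.const_mul τ)) i3]
    refine integral_congr_ae ?_
    filter_upwards [hzw, hIoo] with s h1 h2
    simp only [Pi.add_apply]
    rw [h1, hf's s h2, inner_add_right, inner_add_right, real_inner_smul_right,
      real_inner_smul_right, inner_add_right, h.symm_R₁]
    ring
  have e2 : ∫ s, ‖z s‖ ^ 2 ∂(delayMeasure τ) = ∫ s, ‖w s‖ ^ 2 ∂(delayMeasure τ) :=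
    integral_congr_ae (hzw.mono fun s hs => by simp only [hs])
  have e3 := h.integral_inner_S_deriv hτ.le hw hw' hd
  -- Twice the R₁ form thus equals the form of R₁ + R₂, which is the kernel G.
  have e4 : ∫ s, inner ℝ (w s) (∫ θ, R₁ s θ (w θ) ∂(delayMeasure τ)) ∂(delayMeasure τ)
      = ∫ s, inner ℝ (w s) (∫ θ, R₂ s θ (w θ) ∂(delayMeasure τ)) ∂(delayMeasure τ) :=
    integral_inner_kernel_swap h.continuous_R₁ h.continuous_R₂ h.symm_R₁ hwi hwi
  have hAint : ∀ (A : E →L[ℝ] E) (s : ℝ), inner ℝ x (A (∫ θ, R s θ (w θ) ∂(delayMeasure τ)))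
      = ∫ θ, inner ℝ x (A (R s θ (w θ))) ∂(delayMeasure τ) := fun A s => by
    have hi := integrable_clm_apply (h.continuous_R_right s) hwi
    rw [← A.integral_comp_comm hi, integral_inner (A.integrable_comp hi)]
  have e5 : inner ℝ x (f' 0)
      = inner ℝ x (τ • A₀ (R 0 0 x + S 0 x) + τ • A₁ (R (-τ) 0 x))
        + inner ℝ x (τ • A₁ (S (-τ) (w (-τ))))
        + (∫ s, inner ℝ x (A₀ (R 0 s (w s))) ∂(delayMeasure τ))
        + ∫ s, inner ℝ x (A₁ (R (-τ) s (w s))) ∂(delayMeasure τ) := by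
    rw [hA, hfw 0 ⟨by linarith, le_rfl⟩, hfw (-τ) ⟨le_rfl, by linarith⟩, hw0, ← hAint, ← hAint]
    simp only [map_add, map_smul, smul_add, inner_add_right]
    ring
  have e6 : ∫ s, inner ℝ (w s) (∫ θ, (R₁ s θ + R₂ s θ) (w θ) ∂(delayMeasure τ)) ∂(delayMeasure τ)
      = (∫ s, inner ℝ (w s) (∫ θ, R₁ s θ (w θ) ∂(delayMeasure τ)) ∂(delayMeasure τ))
        + ∫ s, inner ℝ (w s) (∫ θ, R₂ s θ (w θ) ∂(delayMeasure τ)) ∂(delayMeasure τ) := by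
    rw [← integral_add i3 i4]
    congr 1; ext s
    rw [← inner_add_right, ← integral_add (integrable_clm_apply (cR₁s s) hwi)
      (integrable_clm_apply (cR₂s s) hwi)]
    rfl
  have e7 : (∫ s, (2 * inner ℝ x (τ • A₀ (R 0 0 x + S 0 x) + τ • A₁ (R (-τ) 0 x)
          + (1 / 2 : ℝ) • S 0 x)
        + 2 * inner ℝ x (τ • A₁ (S (-τ) (w (-τ)))) - inner ℝ (w (-τ)) (S (-τ) (w (-τ)))
        + 2 * inner ℝ x (τ • (A₀ (R 0 s (w s)) + A₁ (R (-τ) s (w s)) + R₂ 0 s (w s)))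
        + τ * inner ℝ (w s) (S' s (w s)) + ε * (‖x‖ ^ 2 + ‖w s‖ ^ 2)) ∂(delayMeasure τ))
      = τ * (2 * inner ℝ x (τ • A₀ (R 0 0 x + S 0 x) + τ • A₁ (R (-τ) 0 x)
          + (1 / 2 : ℝ) • S 0 x)
        + 2 * inner ℝ x (τ • A₁ (S (-τ) (w (-τ)))) - inner ℝ (w (-τ)) (S (-τ) (w (-τ)))
        + ε * ‖x‖ ^ 2)
        + 2 * τ * (∫ s, inner ℝ x (A₀ (R 0 s (w s))) ∂(delayMeasure τ))
        + 2 * τ * (∫ s, inner ℝ x (A₁ (R (-τ) s (w s))) ∂(delayMeasure τ))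
        + 2 * τ * (∫ s, inner ℝ x (R₂ 0 s (w s)) ∂(delayMeasure τ))
        + τ * (∫ s, inner ℝ (w s) (S' s (w s)) ∂(delayMeasure τ))
        + ε * ∫ s, ‖w s‖ ^ 2 ∂(delayMeasure τ) := by
    set c : ℝ := 2 * inner ℝ x (τ • A₀ (R 0 0 x + S 0 x) + τ • A₁ (R (-τ) 0 x)
          + (1 / 2 : ℝ) • S 0 x)
        + 2 * inner ℝ x (τ • A₁ (S (-τ) (w (-τ)))) - inner ℝ (w (-τ)) (S (-τ) (w (-τ))) with hc
    have hconst : τ * (c + ε * ‖x‖ ^ 2)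
        = ∫ s, (c + ε * ‖x‖ ^ 2) ∂(delayMeasure τ) := by
      rw [integral_const, measureReal_delay hτ.le, smul_eq_mul]
    have j1 := (ic (c + ε * ‖x‖ ^ 2)).add (i5.const_mul (2 * τ))
    have j2 := j1.add (i6.const_mul (2 * τ))
    have j3 := j2.add (i1.const_mul (2 * τ))
    have j4 := j3.add (i2.const_mul τ)
    rw [hconst, ← integral_const_mul, ← integral_const_mul, ← integral_const_mul,
      ← integral_const_mul, ← integral_const_mul,
      ← integral_add' (ic _) (i5.const_mul (2 * τ)),
      ← integral_add' j1 (i6.const_mul (2 * τ)), ← integral_add' j2 (i1.const_mul (2 * τ)),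
      ← integral_add' j3 (i2.const_mul τ), ← integral_add' j4 (i7.const_mul ε)]
    congr 1; ext s
    simp only [Pi.add_apply, real_inner_smul_right, inner_add_right]
    ring
  -- The dissipation condition treats the delayed value as a free vector u; it is used only at u =
  -- w(-τ).
  have hdiss := h.dissipative x (w (-τ)) w hw
  rw [e6, e7] at hdiss
  rw [hw0] at e3
  rw [e1, e2, e5]
  rw [inner_add_right (x := x) (y := τ • A₀ (R 0 0 x + S 0 x) + τ • A₁ (R (-τ) 0 x)),
    real_inner_smul_right x (S 0 x)] at hdiss
  have e3' := congrArg (fun r => τ * r) e3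
  simp only [mul_add, mul_sub] at e3' hdiss ⊢
  linarith

end IsDualCertificate

/-! ### Exponential decay -/

section ExponentialDecay

variable {E : Type*} [NormedAddCommGroup E]

/-- The segment `s ↦ f (t + s)` as an element of `L²[-τ, 0]`. -/
def delaySegment (τ : ℝ) {f : ℝ → E} (hf : Continuous f) (t : ℝ) : Lp E 2 (delayMeasure τ) :=
  (hf.comp (continuous_const_add t)).memLp_delay.toLp _

theorem coeFn_delaySegment (τ : ℝ) {f : ℝ → E} (hf : Continuous f) (t : ℝ) :
    delaySegment τ hf t =ᵐ[delayMeasure τ] fun s => f (t + s) :=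
  MemLp.coeFn_toLp _

variable [InnerProductSpace ℝ E]

/-- The difference quotients converge uniformly on the interval: the mean value inequality for σ ↦
f(σ) - σf'(t+s) bounds the error by the oscillation of f', which is uniformly continuous on a
compact window. A uniform bound then controls the L² norm. -/
theorem hasDerivAt_delaySegment (τ : ℝ) {f f' : ℝ → E} (hf : Continuous f)
    (hd : ∀ s, HasDerivAt f (f' s) s) (hf' : Continuous f') (t : ℝ) :
    HasDerivAt (delaySegment τ hf) (delaySegment τ hf' t) t := by
  rw [hasDerivAt_iff_isLittleO_nhds_zero, Asymptotics.isLittleO_iff]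
  intro c hc
  set K : ℝ := (measureUnivNNReal (delayMeasure τ) : ℝ) ^ (2 : ENNReal).toReal⁻¹ with hK
  have hK0 : 0 ≤ K := by positivity
  -- K converts a sup bound into an L² bound. Dividing by K + 1 keeps the tolerance well defined and
  -- gives K·c/(K + 1) ≤ c.
  have hcK : 0 < c / (K + 1) := by positivity
  have huc : UniformContinuousOn f' (Icc (t - τ - 1) (t + 1)) :=
    isCompact_Icc.uniformContinuousOn_of_continuous hf'.continuousOn
  obtain ⟨δ, hδ, hδ'⟩ := Metric.uniformContinuousOn_iff.1 huc _ hcK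
  filter_upwards [Metric.ball_mem_nhds (0 : ℝ) (lt_min hδ one_pos)] with r hr
  rw [Metric.mem_ball, dist_zero_right, lt_min_iff] at hr
  have hr1 := abs_lt.1 (show |r| < 1 from hr.2)
  have hpt : ∀ s ∈ Icc (-τ) (0 : ℝ),
      ‖f (t + r + s) - f (t + s) - r • f' (t + s)‖ ≤ c / (K + 1) * ‖r‖ := by
    intro s hs
    have hmvt := (convex_uIcc (t + s) (t + r + s)).norm_image_sub_le_of_norm_hasDerivWithin_le
      (f := fun σ => f σ - σ • f' (t + s)) (f' := fun σ => f' σ - f' (t + s))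
      (C := c / (K + 1)) (fun σ _ => ?_) (fun σ hσ => ?_) left_mem_uIcc right_mem_uIcc
    · refine le_trans (le_of_eq ?_) (hmvt.trans (le_of_eq ?_))
      · congr 1
        rw [show r = (t + r + s) - (t + s) by ring, sub_smul]
        simp only [add_sub_add_right_eq_sub, add_sub_cancel_left]
        abel
      · congr 2; ring
    · exact ((hd σ).sub (by simpa using (hasDerivAt_id σ).smul_const (f' (t + s)))).hasDerivWithinAt
    · have h1 : |σ - (t + s)| ≤ |r| := by
        have := abs_sub_left_of_mem_uIcc hσ
        rwa [show t + r + s - (t + s) = r by ring] at this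
      have h2 := abs_le.1 h1
      have h3 := abs_lt.1 (h1.trans_lt hr.2)
      rw [← dist_eq_norm]
      refine (hδ' σ ⟨by linarith [hs.1], by linarith [hs.2]⟩ (t + s)
        ⟨by linarith [hs.1], by linarith [hs.2]⟩ ?_).le
      rw [Real.dist_eq]
      exact h1.trans_lt hr.1
  have hbound : ‖delaySegment τ hf (t + r) - delaySegment τ hf t - r • delaySegment τ hf' t‖
      ≤ K * (c / (K + 1) * ‖r‖) := by
    refine Lp.norm_le_of_ae_bound (by positivity) ?_
    filter_upwards [ae_mem_delayInterval τ, coeFn_delaySegment τ hf (t + r),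
      coeFn_delaySegment τ hf t, coeFn_delaySegment τ hf' t,
      Lp.coeFn_smul r (delaySegment τ hf' t),
      Lp.coeFn_sub (delaySegment τ hf (t + r)) (delaySegment τ hf t),
      Lp.coeFn_sub (delaySegment τ hf (t + r) - delaySegment τ hf t) (r • delaySegment τ hf' t)]
      with s hs h1 h2 h3 h4 h5 h6
    rw [h6, Pi.sub_apply, h5, Pi.sub_apply, h4, Pi.smul_apply, h1, h2, h3]
    exact hpt s hs
  refine hbound.trans ?_
  rw [← mul_assoc]
  refine mul_le_mul_of_nonneg_right ?_ (norm_nonneg r)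
  rw [mul_div_assoc', div_le_iff₀ (by positivity)]
  nlinarith

/-- At 0 the solution has a one-sided derivative only. Freezing the velocity at v(0) for negative
times and integrating gives a C¹ curve on the whole line that agrees with x for t ≥ 0. -/
theorem exists_hasDerivAt_extension [CompleteSpace E] {x v : ℝ → E} (hx : ContinuousOn x (Ici 0))
    (hv : ContinuousOn v (Ici 0)) (hd : ∀ t, 0 ≤ t → HasDerivWithinAt x (v t) (Ici 0) t) :
    ∃ y w : ℝ → E, Continuous w ∧ (∀ t, HasDerivAt y (w t) t) ∧ (∀ t, 0 ≤ t → y t = x t) ∧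
      ∀ t, 0 ≤ t → w t = v t := by
  have hw : Continuous fun t => v (max t 0) :=
    hv.comp_continuous (by fun_prop) fun t => mem_Ici.2 (le_max_right _ _)
  refine ⟨fun t => x 0 + ∫ s in (0 : ℝ)..t, v (max s 0), fun t => v (max t 0), hw, fun t => ?_,
    fun t ht => ?_, fun t ht => congrArg v (max_eq_left ht)⟩
  · exact (intervalIntegral.integral_hasDerivAt_right (hw.intervalIntegrable _ _)
      (hw.stronglyMeasurableAtFilter _ _) hw.continuousAt).const_add _
  · beta_reduce
    rw [intervalIntegral.integral_eq_sub_of_hasDeriv_right_of_le ht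
      (hx.mono Icc_subset_Ici_self) (fun s hs => ?_) (hw.intervalIntegrable _ _)]
    · abel
    · rw [max_eq_left hs.1.le]
      exact (hd s hs.1.le).mono (Ioi_subset_Ici hs.1.le)

/-- On [0, τ] the delayed value is initial data, so A₁x(t - τ) is a forcing term of size at most
‖A₁‖b and Gronwall's inequality applies. -/
theorem exists_norm_delay_solution_le {τ : ℝ} (hτ : 0 ≤ τ) (A₀ A₁ : E →L[ℝ] E) :
    ∃ M, 1 ≤ M ∧ ∀ (x : ℝ → E), ContinuousOn x (Ici (-τ)) →
      (∀ t, 0 ≤ t → HasDerivWithinAt x (A₀ (x t) + A₁ (x (t - τ))) (Ici 0) t) →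
      ∀ b, (∀ s ∈ Icc (-τ) 0, ‖x s‖ ≤ b) → ∀ t ∈ Icc (0 : ℝ) τ, ‖x t‖ ≤ M * b := by
  -- The summand 1 makes K positive, so that the Gronwall bound takes its form for K ≠ 0.
  set K : ℝ := ‖A₀‖ + 1 with hK
  have hK0 : 0 < K := by positivity
  refine ⟨Real.exp (K * τ) + ‖A₁‖ / K * Real.exp (K * τ), ?_, fun x hx hd b hb t ht => ?_⟩
  · have := Real.one_le_exp (by positivity : 0 ≤ K * τ)
    have : 0 ≤ ‖A₁‖ / K * Real.exp (K * τ) := by positivity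
    linarith
  · have hb0 : 0 ≤ b := (norm_nonneg _).trans (hb 0 ⟨by linarith, le_rfl⟩)
    have hg := norm_le_gronwallBound_of_norm_deriv_right_le (a := 0) (b := τ) (δ := b) (K := K)
      (ε := ‖A₁‖ * b) (hx.mono fun s hs => by simp only [mem_Ici]; linarith [hs.1])
      (fun s hs => (hd s hs.1).mono (Ici_subset_Ici.2 hs.1)) (hb 0 ⟨by linarith, le_rfl⟩)
      (fun s hs => ?_) t ht
    · refine hg.trans ?_
      rw [gronwallBound_of_K_ne_0 hK0.ne', sub_zero, add_mul]
      have he : Real.exp (K * t) ≤ Real.exp (K * τ) :=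
        Real.exp_le_exp.2 (mul_le_mul_of_nonneg_left ht.2 hK0.le)
      refine add_le_add ?_ ?_
      · rw [mul_comm]
        exact mul_le_mul_of_nonneg_right he hb0
      · calc ‖A₁‖ * b / K * (Real.exp (K * t) - 1)
            ≤ ‖A₁‖ * b / K * Real.exp (K * τ) :=
              mul_le_mul_of_nonneg_left (by linarith) (by positivity)
          _ = _ := by ring
    · calc ‖A₀ (x s) + A₁ (x (s - τ))‖ ≤ ‖A₀‖ * ‖x s‖ + ‖A₁‖ * b :=
            (norm_add_le _ _).trans (add_le_add (A₀.le_opNorm _) (A₁.le_opNorm_of_le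
              (hb _ ⟨by linarith [hs.1], by linarith [hs.2]⟩)))
        _ ≤ K * ‖x s‖ + ‖A₁‖ * b := by
            have := norm_nonneg (x s)
            rw [hK]; linarith

/-- V(t)·exp(β(t - a)) is nonincreasing on [a, ∞). -/
theorem le_mul_exp_of_hasDerivAt_le {V V' : ℝ → ℝ} {a β : ℝ} (hd : ∀ t, HasDerivAt V (V' t) t)
    (hle : ∀ t, a ≤ t → V' t ≤ -β * V t) {t : ℝ} (ht : a ≤ t) :
    V t ≤ V a * Real.exp (-β * (t - a)) := by
  have hd' : ∀ t, HasDerivAt (fun t => V t * Real.exp (β * (t - a)))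
      (V' t * Real.exp (β * (t - a)) + V t * (Real.exp (β * (t - a)) * β)) t := fun t =>
    (hd t).mul ((((hasDerivAt_id t).sub_const a).const_mul β).exp.congr_deriv (by simp))
  have hanti : AntitoneOn (fun t => V t * Real.exp (β * (t - a))) (Ici a) := by
    refine antitoneOn_of_deriv_nonpos (convex_Ici a)
      (fun t _ => (hd' t).continuousAt.continuousWithinAt)
      (fun t _ => (hd' t).differentiableAt.differentiableWithinAt) fun t ht => ?_
    rw [interior_Ici, mem_Ioi] at ht
    rw [(hd' t).deriv]
    have := mul_le_mul_of_nonneg_right (hle t ht.le) (Real.exp_pos (β * (t - a))).le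
    linarith
  have h1 := hanti self_mem_Ici ht ht
  simp only [sub_self, mul_zero, Real.exp_zero, mul_one] at h1
  calc V t = V t * Real.exp (β * (t - a)) * Real.exp (-β * (t - a)) := by
        rw [mul_assoc, ← Real.exp_add]; simp
    _ ≤ V a * Real.exp (-β * (t - a)) := mul_le_mul_of_nonneg_right h1 (Real.exp_pos _).le

variable [CompleteSpace E] {τ ε : ℝ} {A₀ A₁ : E →L[ℝ] E} {S S' : ℝ → E →L[ℝ] E}
  {R R₁ R₂ : ℝ → ℝ → E →L[ℝ] E}

theorem IsDualCertificate.exponentially_stable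
    (h : IsDualCertificate τ ε A₀ A₁ S S' R R₁ R₂) (hτ : 0 < τ) (hε : 0 < ε) :
    ∃ C α : ℝ, 0 < C ∧ 0 < α ∧ ∀ (x : ℝ → E), ContinuousOn x (Ici (-τ)) →
      (∀ t, 0 ≤ t → HasDerivWithinAt x (A₀ (x t) + A₁ (x (t - τ))) (Ici 0) t) →
      ∀ b, (∀ s ∈ Icc (-τ) 0, ‖x s‖ ≤ b) → ∀ t, 0 ≤ t → ‖x t‖ ≤ C * Real.exp (-α * t) * b := by
  obtain ⟨P, hP₁, hP₂⟩ := h.exists_operator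
  have hcomm := h.inner_operator_comm hP₁ hP₂
  have hcoer := h.le_inner_operator hτ hε hP₁ hP₂
  set m : ℝ := ε * min τ 1 with hm
  have hm0 : 0 < m := by positivity
  have hunit : IsUnit P :=
    ContinuousLinearMap.isUnit_of_forall_le_norm_inner_map P (c := ⟨m, hm0.le⟩) hm0 fun y => by
      rw [real_inner_comm]
      calc ‖y‖ ^ 2 * m = m * ‖y‖ ^ 2 := mul_comm _ _
        _ ≤ _ := (hcoer y).trans (Real.le_norm_self _)
  obtain ⟨Q, hQ⟩ := hunit.exists_right_inv
  have hPQ : ∀ y, P (Q y) = y := fun y => congrArg (fun L : _ →L[ℝ] _ => L y) hQ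
  obtain ⟨M, hM, hgron⟩ := exists_norm_delay_solution_le hτ.le A₀ A₁
  set p : ℝ := ‖P‖ + 1 with hp
  have hp0 : 0 < p := by positivity
  have hPp : ∀ y, ‖P y‖ ≤ p * ‖y‖ := fun y =>
    P.le_of_opNorm_le (by rw [hp]; linarith) y
  -- V decays at rate m/p; the norm of the state is quadratic in V's place, so its own rate is half
  -- of that.
  set α : ℝ := m / (2 * p) with hα
  have hα0 : 0 < α := by positivity
  set c : ℝ := (measureUnivNNReal (delayMeasure τ) : ℝ) ^ (2 : ENNReal).toReal⁻¹ with hc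
  have hc0 : 0 ≤ c := by positivity
  -- L collects the chain τ²‖x(t)‖² ≤ ‖Y(t)‖² ≤ (p²/m)V(t), the decay of V, and V(τ) ≤ ‖Q‖(τ² +
  -- c²)M²b².
  set L : ℝ := p ^ 2 / m * (‖Q‖ * (τ ^ 2 + c ^ 2) * M ^ 2) / τ ^ 2 with hL
  have hL0 : 0 ≤ L := by positivity
  refine ⟨(Real.sqrt L + M) * Real.exp (α * τ), α, by positivity, hα0,
    fun x hx hd b hb t ht => ?_⟩
  have hb0 : 0 ≤ b := (norm_nonneg _).trans (hb 0 ⟨by linarith, le_rfl⟩)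
  have hexp : Real.exp (α * τ) * Real.exp (-α * t) = Real.exp (-α * (t - τ)) := by
    rw [← Real.exp_add]; congr 1; ring
  suffices hmain : ‖x t‖ ≤ (Real.sqrt L + M) * Real.exp (-α * (t - τ)) * b by
    rwa [mul_assoc _ (Real.exp (α * τ)), hexp]
  rcases le_total t τ with htτ | htτ
  · refine (hgron x hx hd b hb t ⟨ht, htτ⟩).trans (mul_le_mul_of_nonneg_right ?_ hb0)
    have h1 : 1 ≤ Real.exp (-α * (t - τ)) := Real.one_le_exp (by nlinarith)
    nlinarith [Real.sqrt_nonneg L]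
  have hx0 : ContinuousOn x (Ici 0) := hx.mono (Ici_subset_Ici.2 (by linarith))
  have hv : ContinuousOn (fun t => A₀ (x t) + A₁ (x (t - τ))) (Ici 0) := by
    refine (A₀.continuous.comp_continuousOn hx0).add (A₁.continuous.comp_continuousOn
      (hx.comp (by fun_prop) fun s hs => ?_))
    simp only [mem_Ici] at hs ⊢
    linarith
  obtain ⟨y, w, hw, hyd, hyx, hwv⟩ := exists_hasDerivAt_extension hx0 hv hd
  have hy : Continuous y := continuous_iff_continuousAt.2 fun s => (hyd s).continuousAt
  let e := (WithLp.prodContinuousLinearEquiv 2 ℝ E (Lp E 2 (delayMeasure τ))).symm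
  -- The factor τ on the point value matches the first component of P.
  let Y : ℝ → DelayState E τ := fun t => e (τ • y t, delaySegment τ hy t)
  let Y' : ℝ → DelayState E τ := fun t => e (τ • w t, delaySegment τ hw t)
  have hY : ∀ t, HasDerivAt Y (Y' t) t := fun t =>
    (e : E × Lp E 2 (delayMeasure τ) →L[ℝ] DelayState E τ).hasFDerivAt.comp_hasDerivAt t
      (((hyd t).const_smul τ).prodMk (hasDerivAt_delaySegment τ hy hyd hw t))
  let V : ℝ → ℝ := fun t => inner ℝ (Y t) (Q (Y t))
  have hV : ∀ t, HasDerivAt V (2 * inner ℝ (Q (Y t)) (Y' t)) t := fun t => by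
    refine ((hY t).inner ℝ (Q.hasFDerivAt.comp_hasDerivAt t (hY t))).congr_deriv ?_
    -- Symmetry of the inverse follows from that of P: ⟨Y, QY'⟩ = ⟨PQY, QY'⟩ = ⟨QY, PQY'⟩.
    have h1 : inner ℝ (Y t) (Q (Y' t)) = inner ℝ (Q (Y t)) (Y' t) := by
      conv_lhs => rw [← hPQ (Y t), real_inner_comm, hcomm, hPQ]
    have h2 : inner ℝ (Y' t) ((Q ∘ Y) t) = inner ℝ (Q (Y t)) (Y' t) := real_inner_comm _ _
    rw [h1, h2]
    ring
  have hVk : ∀ t, V t = inner ℝ (Q (Y t)) (P (Q (Y t))) := fun t => by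
    rw [hPQ, real_inner_comm]
  -- For t ≥ τ the window [t - τ, t] lies in [0, ∞), where the extension y agrees with x, so the
  -- delay equation holds for y at t.
  have hdiss : ∀ t, τ ≤ t → 2 * inner ℝ (Q (Y t)) (Y' t) ≤ -(m / p) * V t := fun t ht => by
    have hPk := hPQ (Y t)
    set k := Q (Y t) with hk
    have h1 : τ • (R 0 0 k.ofLp.1 + S 0 k.ofLp.1) + ∫ s, R 0 s (k.ofLp.2 s) ∂(delayMeasure τ)
        = y (t + 0) := by
      have h2 := hP₁ k
      rw [hPk, add_zero] at *
      exact (smul_right_injective E hτ.ne' h2).symm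
    have h2 : (fun s => τ • R s 0 k.ofLp.1 + τ • S s (k.ofLp.2 s)
        + ∫ θ, R s θ (k.ofLp.2 θ) ∂(delayMeasure τ)) =ᵐ[delayMeasure τ] fun s => y (t + s) := by
      refine (hP₂ k).symm.trans ?_
      rw [hPk]
      exact coeFn_delaySegment τ hy t
    have h3 := h.inner_deriv_le hτ hε (f := fun s => y (t + s)) (f' := fun s => w (t + s))
      (fun s => by simpa using (hyd (t + s)).comp_const_add t s)
      (hw.comp (continuous_const_add t)) h1 h2 (by
        rw [add_zero, hwv t (by linarith), hyx t (by linarith), hyx _ (by linarith),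
          sub_eq_add_neg])
    have h4 : inner ℝ k (Y' t) = τ * inner ℝ k.ofLp.1 (w (t + 0))
        + ∫ s, inner ℝ (k.ofLp.2 s) (w (t + s)) ∂(delayMeasure τ) := by
      rw [WithLp.prod_inner_apply, L2.inner_def, add_zero]
      congr 1
      · exact real_inner_smul_right _ _ _
      · refine integral_congr_ae ?_
        filter_upwards [coeFn_delaySegment τ hw t] with s hs
        exact congrArg _ hs
    have h5 : ‖k‖ ^ 2 = ‖k.ofLp.1‖ ^ 2 + ∫ s, ‖k.ofLp.2 s‖ ^ 2 ∂(delayMeasure τ) := by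
      rw [← real_inner_self_eq_norm_sq, WithLp.prod_inner_apply, L2.inner_def]
      simp_rw [real_inner_self_eq_norm_sq]
    have h6 : m * ‖k‖ ^ 2 ≤ ε * (τ * ‖k.ofLp.1‖ ^ 2
        + ∫ s, ‖k.ofLp.2 s‖ ^ 2 ∂(delayMeasure τ)) := by
      rw [h5, hm, mul_assoc]
      refine mul_le_mul_of_nonneg_left ?_ hε.le
      have hI : 0 ≤ ∫ s, ‖k.ofLp.2 s‖ ^ 2 ∂(delayMeasure τ) :=
        integral_nonneg fun s => by positivity
      nlinarith [min_le_right τ 1, min_le_left τ 1, sq_nonneg ‖k.ofLp.1‖]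
    have h7 : V t ≤ p * ‖k‖ ^ 2 := by
      rw [hVk]
      calc inner ℝ k (P k) ≤ ‖k‖ * ‖P k‖ := real_inner_le_norm _ _
        _ ≤ ‖k‖ * (p * ‖k‖) := mul_le_mul_of_nonneg_left (hPp k) (norm_nonneg _)
        _ = p * ‖k‖ ^ 2 := by ring
    have h8 : m / p * V t ≤ m * ‖k‖ ^ 2 := by
      calc m / p * V t ≤ m / p * (p * ‖k‖ ^ 2) :=
            mul_le_mul_of_nonneg_left h7 (by positivity)
        _ = m * ‖k‖ ^ 2 := by field_simp
    rw [h4]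
    linarith
  have hdecay := le_mul_exp_of_hasDerivAt_le hV hdiss htτ
  have hYsq : ∀ t, ‖Y t‖ ^ 2 = τ ^ 2 * ‖y t‖ ^ 2 + ‖delaySegment τ hy t‖ ^ 2 := fun t => by
    rw [WithLp.prod_norm_sq_eq_of_L2]
    change ‖τ • y t‖ ^ 2 + _ = _
    rw [norm_smul, mul_pow, Real.norm_of_nonneg hτ.le]
    rfl
  have hYV : ‖Y t‖ ^ 2 ≤ p ^ 2 / m * V t := by
    have h1 := hPp (Q (Y t))
    rw [hPQ] at h1
    have h2 := hcoer (Q (Y t))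
    rw [← hVk] at h2
    calc ‖Y t‖ ^ 2 ≤ (p * ‖Q (Y t)‖) ^ 2 := pow_le_pow_left₀ (norm_nonneg _) h1 2
      _ = p ^ 2 / m * (m * ‖Q (Y t)‖ ^ 2) := by field_simp
      _ ≤ p ^ 2 / m * V t := mul_le_mul_of_nonneg_left h2 (by positivity)
  have hVτ : V τ ≤ ‖Q‖ * (τ ^ 2 + c ^ 2) * M ^ 2 * b ^ 2 := by
    have hyb : ∀ t ∈ Icc (0 : ℝ) τ, ‖y t‖ ≤ M * b := fun t ht => by
      rw [hyx t ht.1]; exact hgron x hx hd b hb t ht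
    have h1 : ‖delaySegment τ hy τ‖ ≤ c * (M * b) := by
      refine Lp.norm_le_of_ae_bound (by positivity) ?_
      filter_upwards [coeFn_delaySegment τ hy τ, ae_mem_delayInterval τ] with s hs hsI
      rw [hs]
      exact hyb _ ⟨by linarith [hsI.1], by linarith [hsI.2]⟩
    have h2 : ‖Y τ‖ ^ 2 ≤ (τ ^ 2 + c ^ 2) * M ^ 2 * b ^ 2 := by
      rw [hYsq]
      have h3 := pow_le_pow_left₀ (norm_nonneg _) h1 2
      have h4 := mul_le_mul_of_nonneg_left
        (pow_le_pow_left₀ (norm_nonneg _) (hyb τ ⟨hτ.le, le_rfl⟩) 2) (sq_nonneg τ)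
      calc _ ≤ τ ^ 2 * (M * b) ^ 2 + (c * (M * b)) ^ 2 := add_le_add h4 h3
        _ = _ := by ring
    calc V τ ≤ ‖Y τ‖ * ‖Q (Y τ)‖ := real_inner_le_norm _ _
      _ ≤ ‖Y τ‖ * (‖Q‖ * ‖Y τ‖) := mul_le_mul_of_nonneg_left (Q.le_opNorm _) (norm_nonneg _)
      _ = ‖Q‖ * ‖Y τ‖ ^ 2 := by ring
      _ ≤ ‖Q‖ * ((τ ^ 2 + c ^ 2) * M ^ 2 * b ^ 2) := mul_le_mul_of_nonneg_left h2 (by positivity)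
      _ = _ := by ring
  have hfinal : ‖x t‖ ^ 2 ≤ (Real.sqrt L * Real.exp (-α * (t - τ)) * b) ^ 2 := by
    have hE : Real.exp (-(m / p) * (t - τ)) = Real.exp (-α * (t - τ)) ^ 2 := by
      rw [← Real.exp_nat_mul]; congr 1; rw [hα]; push_cast; field_simp
    have h1 : τ ^ 2 * ‖x t‖ ^ 2 ≤ ‖Y t‖ ^ 2 := by
      rw [hYsq, hyx t ht]; nlinarith [sq_nonneg ‖delaySegment τ hy t‖]
    have h2 : V t ≤ ‖Q‖ * (τ ^ 2 + c ^ 2) * M ^ 2 * b ^ 2 * Real.exp (-α * (t - τ)) ^ 2 := by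
      rw [← hE]
      exact hdecay.trans (mul_le_mul_of_nonneg_right hVτ (Real.exp_pos _).le)
    have h3 := h1.trans (hYV.trans (mul_le_mul_of_nonneg_left h2 (by positivity)))
    rw [mul_pow, mul_pow, Real.sq_sqrt hL0, hL, ← mul_le_mul_iff_right₀ (sq_pos_of_pos hτ)]
    refine h3.trans (le_of_eq ?_)
    field_simp
  have hnn : 0 ≤ Real.sqrt L * Real.exp (-α * (t - τ)) * b := by positivity
  refine ((pow_le_pow_iff_left₀ (norm_nonneg _) hnn two_ne_zero).1 hfinal).trans ?_
  refine mul_le_mul_of_nonneg_right (mul_le_mul_of_nonneg_right ?_ (Real.exp_pos _).le) hb0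
  linarith

end ExponentialDecay

/-! ### Quadratic forms of multiplier and kernel pairs -/

section QuadraticForms

theorem Continuous.integrable_delay_prod {τ : ℝ} {f : ℝ × ℝ → ℝ} (hf : Continuous f) :
    Integrable f ((delayMeasure τ).prod (delayMeasure τ)) := by
  rw [Measure.prod_restrict]
  exact hf.continuousOn.integrableOn_compact (isCompact_Icc.prod isCompact_Icc)

theorem integral_swap_delay (τ : ℝ) {f : ℝ → ℝ → ℝ} (hf : Continuous (Function.uncurry f)) :
    ∫ s, ∫ θ, f s θ ∂(delayMeasure τ) ∂(delayMeasure τ) =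
      ∫ θ, ∫ s, f s θ ∂(delayMeasure τ) ∂(delayMeasure τ) :=
  integral_integral_swap hf.integrable_delay_prod

theorem integral_add₃_delay (τ : ℝ) {f g h : ℝ → ℝ} (hf : Continuous f) (hg : Continuous g)
    (hh : Continuous h) :
    ∫ s, (f s + g s + h s) ∂(delayMeasure τ) = (∫ s, f s ∂(delayMeasure τ))
      + (∫ s, g s ∂(delayMeasure τ)) + ∫ s, h s ∂(delayMeasure τ) := by
  rw [← integral_add' hf.integrable_delay hg.integrable_delay,
    ← integral_add' (hf.add hg).integrable_delay hh.integrable_delay]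
  rfl

theorem restrict_delaySquare (τ : ℝ) :
    (volume : Measure (ℝ × ℝ)).restrict (delaySquare τ)
      = (delayMeasure τ).prod (delayMeasure τ) := by
  rw [Measure.prod_restrict, ← Measure.volume_eq_prod]; rfl

theorem integral_dotProduct {α κ : Type*} [Fintype κ] [MeasurableSpace α] {ρ : Measure α}
    (u : κ → ℝ) {y : α → κ → ℝ} (hy : ∀ k, Integrable (fun a => y a k) ρ) :
    ∫ a, u ⬝ᵥ y a ∂ρ = u ⬝ᵥ fun k => ∫ a, y a k ∂ρ := by
  simp only [dotProduct]
  rw [integral_finsetSum _ fun k _ => (hy k).const_mul (u k)]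
  simp_rw [integral_const_mul]

theorem dotProduct_matIntegral_mulVec {α β : Type*} [Fintype α] [Fintype β] {τ : ℝ}
    {L : ℝ → Matrix α β ℝ} (hL : ∀ i j, Integrable (fun s => L s i j) (delayMeasure τ))
    (u : α → ℝ) (w : β → ℝ) :
    u ⬝ᵥ matIntegral τ L *ᵥ w = ∫ s, u ⬝ᵥ L s *ᵥ w ∂(delayMeasure τ) := by
  rw [integral_dotProduct u fun i => ?_]
  · congr 1; ext i
    simp only [mulVec]
    simp_rw [dotProduct_comm _ w]
    rw [integral_dotProduct w (hL i)]
    rfl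
  · simp only [mulVec, dotProduct]
    exact integrable_finsetSum _ fun j _ => (hL i j).mul_const _

variable {ι : Type} [DecidableEq ι]

theorem continuous_basisOne (d : ℕ) : Continuous (basisOne ι d) :=
  continuous_matrix fun i j => by simp only [basisOne, of_apply]; fun_prop

theorem continuous_basisTwo (d : ℕ) : Continuous fun p : ℝ × ℝ => basisTwo ι d p.1 p.2 :=
  continuous_matrix fun i j => by simp only [basisTwo, of_apply]; fun_prop

theorem continuous_basisTwo_comp {X : Type*} [TopologicalSpace X] (d : ℕ) {f g : X → ℝ}
    (hf : Continuous f) (hg : Continuous g) : Continuous fun x => basisTwo ι d (f x) (g x) :=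
  (continuous_basisTwo d).comp (hf.prodMk hg)

variable [Fintype ι]

/-- The integrand of the quadratic form of an SOS pair. -/
theorem dotProduct_sosKernel_mulVec (τ : ℝ) (d : ℕ) {g : ℝ → ℝ} (hg : Continuous g)
    (Q₁₂ : Matrix (Fin (d + 1) × ι) (BiDegree d × ι) ℝ)
    (Q₂₂ : Matrix (BiDegree d × ι) (BiDegree d × ι) ℝ) (s θ : ℝ) (u w : ι → ℝ) :
    u ⬝ᵥ sosKernel τ d g Q₁₂ Q₂₂ s θ *ᵥ w =
      g s * ((basisOne ι d s *ᵥ u) ⬝ᵥ Q₁₂ *ᵥ (basisTwo ι d s θ *ᵥ w))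
      + g θ * ((basisOne ι d θ *ᵥ w) ⬝ᵥ Q₁₂ *ᵥ (basisTwo ι d θ s *ᵥ u))
      + ∫ η, g η * ((basisTwo ι d η s *ᵥ u) ⬝ᵥ Q₂₂ *ᵥ (basisTwo ι d η θ *ᵥ w))
        ∂(delayMeasure τ) := by
  have hc : Continuous fun η => g η • ((basisTwo ι d η s)ᵀ * Q₂₂ * basisTwo ι d η θ) := by
    have h1 := continuous_basisTwo_comp (ι := ι) d continuous_id (continuous_const (y := s))
    have h2 := continuous_basisTwo_comp (ι := ι) d continuous_id (continuous_const (y := θ))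
    exact hg.smul ((h1.matrix_transpose.matrix_mul continuous_const).matrix_mul h2)
  have key : ∀ {α β : Type} [Fintype α] [Fintype β] (A : Matrix α ι ℝ) (B : Matrix α β ℝ)
      (C : Matrix β ι ℝ), u ⬝ᵥ (Aᵀ * B * C) *ᵥ w = (A *ᵥ u) ⬝ᵥ B *ᵥ (C *ᵥ w) := by
    intro α β _ _ A B C
    rw [← mulVec_mulVec, ← mulVec_mulVec, dotProduct_transpose_mulVec, dotProduct_comm]
  rw [sosKernel, add_mulVec, add_mulVec, dotProduct_add, dotProduct_add,
    dotProduct_matIntegral_mulVec fun i j => (hc.matrix_elem i j).integrable_delay]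
  simp only [smul_mulVec, dotProduct_smul, smul_eq_mul, key]
  rw [dotProduct_transpose_mulVec]

theorem dotProduct_sosMultiplier_mulVec (d : ℕ) (g : ℝ → ℝ)
    (Q₁₁ : Matrix (Fin (d + 1) × ι) (Fin (d + 1) × ι) ℝ) (s : ℝ) (u : ι → ℝ) :
    u ⬝ᵥ sosMultiplier d g Q₁₁ s *ᵥ u =
      g s * ((basisOne ι d s *ᵥ u) ⬝ᵥ Q₁₁ *ᵥ (basisOne ι d s *ᵥ u)) := by
  rw [sosMultiplier, smul_mulVec, dotProduct_smul, smul_eq_mul, ← mulVec_mulVec, ← mulVec_mulVec,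
    dotProduct_transpose_mulVec, dotProduct_comm]

theorem fromBlocks_form {α β : Type} [Fintype α] [Fintype β] (A : Matrix α α ℝ)
    (B : Matrix α β ℝ) (D : Matrix β β ℝ) (u : α → ℝ) (w : β → ℝ) :
    Sum.elim u w ⬝ᵥ fromBlocks A B Bᵀ D *ᵥ Sum.elim u w =
      u ⬝ᵥ A *ᵥ u + 2 * (u ⬝ᵥ B *ᵥ w) + w ⬝ᵥ D *ᵥ w := by
  rw [fromBlocks_mulVec, sumElim_dotProduct_sumElim]
  simp only [Sum.elim_comp_inl, Sum.elim_comp_inr, dotProduct_add, dotProduct_transpose_mulVec]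
  ring

/-- The quadratic form of an SOS pair is nonnegative. -/
theorem IsSosPair.form_nonneg {τ : ℝ} {d : ℕ} {g : ℝ → ℝ} {M : ℝ → Matrix ι ι ℝ}
    {N : ℝ → ℝ → Matrix ι ι ℝ} (h : IsSosPair τ d g M N) (hg : Continuous g)
    (hg0 : ∀ s ∈ Icc (-τ) (0 : ℝ), 0 ≤ g s) {v : ℝ → ι → ℝ} (hv : Continuous v) :
    0 ≤ (∫ s, v s ⬝ᵥ M s *ᵥ v s ∂(delayMeasure τ))
      + ∫ s, ∫ θ, v s ⬝ᵥ N s θ *ᵥ v θ ∂(delayMeasure τ) ∂(delayMeasure τ) := by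
  obtain ⟨Q₁₁, Q₁₂, Q₂₂, hQ, hM, hN⟩ := h
  let a : ℝ → Fin (d + 1) × ι → ℝ := fun s => basisOne ι d s *ᵥ v s
  let y : ℝ → ℝ → BiDegree d × ι → ℝ := fun η θ => basisTwo ι d η θ *ᵥ v θ
  -- Together with a this is the vector on which Q acts: Y₂(η,θ)v(θ) with θ integrated out.
  let b : ℝ → BiDegree d × ι → ℝ := fun η k => ∫ θ, y η θ k ∂(delayMeasure τ)
  have ha : Continuous a := (continuous_basisOne d).matrix_mulVec hv
  have hy : Continuous fun p : ℝ × ℝ => y p.1 p.2 :=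
    (continuous_basisTwo d).matrix_mulVec (hv.comp continuous_snd)
  have hyη : ∀ η, Continuous (y η) := fun η => hy.comp (Continuous.prodMk_right η)
  have hb : Continuous b := continuous_pi fun k =>
    continuous_parametric_integral_of_continuous (μ := volume) (s := Icc (-τ) 0)
      (f := fun η θ => y η θ k) ((continuous_apply k).comp hy) isCompact_Icc
  have hyi : ∀ η k, Integrable (fun θ => y η θ k) (delayMeasure τ) := fun η k =>
    ((continuous_apply k).comp (hyη η)).integrable_delay
  have hint : ∀ {α : Type} [Fintype α] (c : ℝ) (u : α → ℝ) (A : Matrix α (BiDegree d × ι) ℝ) η,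
      ∫ θ, c * (u ⬝ᵥ A *ᵥ y η θ) ∂(delayMeasure τ) = c * (u ⬝ᵥ A *ᵥ b η) := by
    intro α _ c u A η
    rw [integral_const_mul]
    simp_rw [dotProduct_mulVec]
    rw [integral_dotProduct _ (hyi η)]
  have hinner : ∀ s, ∫ θ, v s ⬝ᵥ N s θ *ᵥ v θ ∂(delayMeasure τ) =
      g s * (a s ⬝ᵥ Q₁₂ *ᵥ b s) + (∫ θ, g θ * (a θ ⬝ᵥ Q₁₂ *ᵥ y θ s) ∂(delayMeasure τ))
        + ∫ η, g η * (b η ⬝ᵥ Q₂₂ *ᵥ y η s) ∂(delayMeasure τ) := by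
    intro s
    have c1 : Continuous fun θ => g s * (a s ⬝ᵥ Q₁₂ *ᵥ y s θ) :=
      continuous_const.mul (continuous_const.dotProduct
        (continuous_const.matrix_mulVec (hyη s)))
    have hys : Continuous fun θ => y θ s := hy.comp (Continuous.prodMk_left s)
    have c2 : Continuous fun θ => g θ * (a θ ⬝ᵥ Q₁₂ *ᵥ y θ s) :=
      hg.mul (ha.dotProduct (continuous_const.matrix_mulVec hys))
    have c3 : Continuous fun p : ℝ × ℝ => g p.2 * (y p.2 s ⬝ᵥ Q₂₂ *ᵥ y p.2 p.1) :=
      (hg.comp continuous_snd).mul ((hys.comp continuous_snd).dotProduct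
        (continuous_const.matrix_mulVec (hy.comp continuous_swap)))
    have c4 : Continuous fun θ => ∫ η, g η * (y η s ⬝ᵥ Q₂₂ *ᵥ y η θ) ∂(delayMeasure τ) :=
      continuous_parametric_integral_of_continuous (μ := volume) (s := Icc (-τ) 0)
        (f := fun θ η => g η * (y η s ⬝ᵥ Q₂₂ *ᵥ y η θ)) c3 isCompact_Icc
    have hsymm : Q₂₂ᵀ = Q₂₂ := by
      have := hQ.1
      rw [isHermitian_fromBlocks_iff] at this
      simpa only [IsHermitian, conjTranspose_eq_transpose_of_trivial] using this.2.2.2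
    -- Integrating over θ first replaces y(η,θ) by b(η); symmetry of Q₂₂ then moves b to the left.
    have hsw : ∫ θ, ∫ η, g η * (y η s ⬝ᵥ Q₂₂ *ᵥ y η θ) ∂(delayMeasure τ) ∂(delayMeasure τ)
        = ∫ η, g η * (b η ⬝ᵥ Q₂₂ *ᵥ y η s) ∂(delayMeasure τ) := by
      rw [integral_swap_delay τ (f := fun θ η => g η * (y η s ⬝ᵥ Q₂₂ *ᵥ y η θ)) c3]
      refine integral_congr_ae (Filter.Eventually.of_forall fun η => ?_)
      beta_reduce
      rw [hint, ← dotProduct_transpose_mulVec, hsymm]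
    rw [← hsw, ← hint, ← integral_add₃_delay τ c1 c2 c4]
    refine integral_congr_ae (Filter.Eventually.of_forall fun θ => ?_)
    beta_reduce
    rw [hN, dotProduct_sosKernel_mulVec τ d hg]
  have k2 : Continuous fun p : ℝ × ℝ => g p.2 * (a p.2 ⬝ᵥ Q₁₂ *ᵥ y p.2 p.1) :=
    (hg.comp continuous_snd).mul ((ha.comp continuous_snd).dotProduct
      (continuous_const.matrix_mulVec (hy.comp continuous_swap)))
  have k3 : Continuous fun p : ℝ × ℝ => g p.2 * (b p.2 ⬝ᵥ Q₂₂ *ᵥ y p.2 p.1) :=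
    (hg.comp continuous_snd).mul ((hb.comp continuous_snd).dotProduct
      (continuous_const.matrix_mulVec (hy.comp continuous_swap)))
  have m1 : Continuous fun s => g s * (a s ⬝ᵥ Q₁₂ *ᵥ b s) :=
    hg.mul (ha.dotProduct (continuous_const.matrix_mulVec hb))
  have m2 : Continuous fun s => ∫ θ, g θ * (a θ ⬝ᵥ Q₁₂ *ᵥ y θ s) ∂(delayMeasure τ) :=
    continuous_parametric_integral_of_continuous (μ := volume) (s := Icc (-τ) 0)
      (f := fun s θ => g θ * (a θ ⬝ᵥ Q₁₂ *ᵥ y θ s)) k2 isCompact_Icc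
  have m3 : Continuous fun s => ∫ η, g η * (b η ⬝ᵥ Q₂₂ *ᵥ y η s) ∂(delayMeasure τ) :=
    continuous_parametric_integral_of_continuous (μ := volume) (s := Icc (-τ) 0)
      (f := fun s θ => g θ * (b θ ⬝ᵥ Q₂₂ *ᵥ y θ s)) k3 isCompact_Icc
  have m0 : Continuous fun s => g s * (a s ⬝ᵥ Q₁₁ *ᵥ a s) :=
    hg.mul (ha.dotProduct (continuous_const.matrix_mulVec ha))
  have m4 : Continuous fun s => g s * (b s ⬝ᵥ Q₂₂ *ᵥ b s) :=
    hg.mul (hb.dotProduct (continuous_const.matrix_mulVec hb))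
  have e1 : ∫ s, v s ⬝ᵥ M s *ᵥ v s ∂(delayMeasure τ)
      = ∫ s, g s * (a s ⬝ᵥ Q₁₁ *ᵥ a s) ∂(delayMeasure τ) := by
    simp_rw [hM, dotProduct_sosMultiplier_mulVec]
    rfl
  simp_rw [hinner]
  rw [e1, integral_add₃_delay τ m1 m2 m3,
    integral_swap_delay τ (f := fun s θ => g θ * (a θ ⬝ᵥ Q₁₂ *ᵥ y θ s)) k2,
    integral_swap_delay τ (f := fun s θ => g θ * (b θ ⬝ᵥ Q₂₂ *ᵥ y θ s)) k3]
  simp_rw [hint]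
  -- After Fubini both cross terms are the same integral, which accounts for the factor 2.
  have hsum := integral_add₃_delay τ m0 (m1.const_mul 2) m4
  rw [integral_const_mul] at hsum
  suffices hnn : 0 ≤ ∫ s, (g s * (a s ⬝ᵥ Q₁₁ *ᵥ a s) + 2 * (g s * (a s ⬝ᵥ Q₁₂ *ᵥ b s))
      + g s * (b s ⬝ᵥ Q₂₂ *ᵥ b s)) ∂(delayMeasure τ) by linarith
  refine integral_nonneg_of_ae ?_
  filter_upwards [ae_mem_delayInterval τ] with s hs
  have hpos := hQ.dotProduct_mulVec_nonneg (Sum.elim (a s) (b s))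
  rw [star_trivial, fromBlocks_form] at hpos
  have := mul_nonneg (hg0 s hs) hpos
  simp only [Pi.zero_apply]
  linarith

end QuadraticForms

/-! ### Regularity and positivity of pairs in Ξ, and vanishing of the forms of Θ -/

section XiTheta

variable {ι : Type} [Fintype ι] [DecidableEq ι]

/-- The variable η separates from s and θ, so the integral is a polynomial in (s, θ) with moments of
g as coefficients; its smoothness is then evident. -/
theorem matIntegral_basisTwo_apply (τ : ℝ) (d : ℕ) {g : ℝ → ℝ} (hg : Continuous g)
    (Q : Matrix (BiDegree d × ι) (BiDegree d × ι) ℝ) (s θ : ℝ) (i j : ι) :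
    matIntegral τ (fun η => g η • ((basisTwo ι d η s)ᵀ * Q * basisTwo ι d η θ)) i j =
      ∑ b : BiDegree d × ι, ∑ a : BiDegree d × ι,
        (s ^ a.1.val.2.val * (1 : Matrix ι ι ℝ) a.2 i * Q a b
          * (θ ^ b.1.val.2.val * (1 : Matrix ι ι ℝ) b.2 j))
        * ∫ η, g η * η ^ a.1.val.1.val * η ^ b.1.val.1.val ∂(delayMeasure τ) := by
  have h : ∀ η, (g η • ((basisTwo ι d η s)ᵀ * Q * basisTwo ι d η θ)) i j =
      ∑ b : BiDegree d × ι, ∑ a : BiDegree d × ι,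
        (s ^ a.1.val.2.val * (1 : Matrix ι ι ℝ) a.2 i * Q a b
          * (θ ^ b.1.val.2.val * (1 : Matrix ι ι ℝ) b.2 j))
        * (g η * η ^ a.1.val.1.val * η ^ b.1.val.1.val) := fun η => by
    rw [Matrix.smul_apply, mul_apply, smul_eq_mul, Finset.mul_sum]
    refine Finset.sum_congr rfl fun b _ => ?_
    rw [mul_apply, Finset.sum_mul, Finset.mul_sum]
    refine Finset.sum_congr rfl fun a _ => ?_
    simp only [transpose_apply, basisTwo, of_apply]
    ring
  have hi : ∀ a b : BiDegree d × ι, Integrable (fun η =>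
      (s ^ a.1.val.2.val * (1 : Matrix ι ι ℝ) a.2 i * Q a b
          * (θ ^ b.1.val.2.val * (1 : Matrix ι ι ℝ) b.2 j))
        * (g η * η ^ a.1.val.1.val * η ^ b.1.val.1.val)) (delayMeasure τ) := fun a b =>
    Continuous.integrable_delay (by fun_prop)
  change ∫ η, (g η • ((basisTwo ι d η s)ᵀ * Q * basisTwo ι d η θ)) i j ∂(delayMeasure τ) = _
  simp_rw [h]
  rw [integral_finsetSum _ fun b _ => integrable_finsetSum _ fun a _ => hi a b]
  refine Finset.sum_congr rfl fun b _ => ?_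
  rw [integral_finsetSum _ fun a _ => hi a b]
  simp_rw [integral_const_mul]

theorem IsSosPair.contDiff_multiplier {τ : ℝ} {d : ℕ} {g : ℝ → ℝ} {M : ℝ → Matrix ι ι ℝ}
    {N : ℝ → ℝ → Matrix ι ι ℝ} (h : IsSosPair τ d g M N) (hg : ContDiff ℝ 1 g) (i j : ι) :
    ContDiff ℝ 1 fun s => M s i j := by
  obtain ⟨Q₁₁, Q₁₂, Q₂₂, -, hM, -⟩ := h
  simp only [hM, sosMultiplier, Matrix.smul_apply, mul_apply, transpose_apply, basisOne, of_apply,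
    smul_eq_mul]
  fun_prop

theorem IsSosPair.contDiff_kernel {τ : ℝ} {d : ℕ} {g : ℝ → ℝ} {M : ℝ → Matrix ι ι ℝ}
    {N : ℝ → ℝ → Matrix ι ι ℝ} (h : IsSosPair τ d g M N) (hg : ContDiff ℝ 1 g) (i j : ι) :
    ContDiff ℝ 1 fun p : ℝ × ℝ => N p.1 p.2 i j := by
  obtain ⟨Q₁₁, Q₁₂, Q₂₂, -, -, hN⟩ := h
  simp only [hN, sosKernel, Matrix.add_apply, matIntegral_basisTwo_apply τ d hg.continuous]
  simp only [Matrix.smul_apply, mul_apply, transpose_apply, basisOne, basisTwo, of_apply, smul_eq_mul]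
  fun_prop

/-- Q₁₁ is a principal block of Q, hence positive semidefinite. -/
theorem IsSosPair.multiplier_nonneg {τ : ℝ} {d : ℕ} {g : ℝ → ℝ} {M : ℝ → Matrix ι ι ℝ}
    {N : ℝ → ℝ → Matrix ι ι ℝ} (h : IsSosPair τ d g M N) {s : ℝ} (hs : 0 ≤ g s) (u : ι → ℝ) :
    0 ≤ u ⬝ᵥ M s *ᵥ u := by
  obtain ⟨Q₁₁, Q₁₂, Q₂₂, hQ, hM, -⟩ := h
  rw [hM, dotProduct_sosMultiplier_mulVec]
  refine mul_nonneg hs ?_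
  have := hQ.dotProduct_mulVec_nonneg (Sum.elim (basisOne ι d s *ᵥ u) 0)
  rw [star_trivial, fromBlocks_form] at this
  simpa using this

theorem weight_nonneg {τ : ℝ} : ∀ s ∈ Icc (-τ) (0 : ℝ), 0 ≤ -(s * (s + τ)) := fun s hs => by
  nlinarith [hs.1, hs.2, mul_nonneg (neg_nonneg.2 hs.2) (by linarith [hs.1] : 0 ≤ s + τ)]

/-- A member of `Ξ` agrees almost everywhere with a continuously differentiable pair whose
multiplier is positive semidefinite on the interval and whose quadratic form is nonnegative. -/
theorem Xi.exists_contDiff {τ : ℝ} {d : ℕ}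
    {P : (ℝ → Matrix ι ι ℝ) × (ℝ → ℝ → Matrix ι ι ℝ)} (h : P ∈ Xi τ d) :
    ∃ (M : ℝ → Matrix ι ι ℝ) (N : ℝ → ℝ → Matrix ι ι ℝ),
      (∀ i j, ContDiff ℝ 1 fun s => M s i j) ∧
      (∀ i j, ContDiff ℝ 1 fun p : ℝ × ℝ => N p.1 p.2 i j) ∧
      (∀ s ∈ Icc (-τ) 0, ∀ u, 0 ≤ u ⬝ᵥ M s *ᵥ u) ∧
      (∀ v : ℝ → ι → ℝ, Continuous v → 0 ≤ (∫ s, v s ⬝ᵥ M s *ᵥ v s ∂(delayMeasure τ))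
        + ∫ p, v p.1 ⬝ᵥ N p.1 p.2 *ᵥ v p.2 ∂((delayMeasure τ).prod (delayMeasure τ))) ∧
      (∀ᵐ s ∂(delayMeasure τ), P.1 s = M s) ∧
      (∀ᵐ p ∂((delayMeasure τ).prod (delayMeasure τ)), P.2 p.1 p.2 = N p.1 p.2) := by
  obtain ⟨M₁, M₂, N₁, N₂, h₁, h₂, hM, hN⟩ := h
  rw [restrict_delaySquare] at hN
  have g₁ : ContDiff ℝ 1 fun _ : ℝ => (1 : ℝ) := contDiff_const
  have g₂ : ContDiff ℝ 1 fun s : ℝ => -(s * (s + τ)) := by fun_prop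
  refine ⟨fun s => M₁ s + M₂ s, fun s θ => N₁ s θ + N₂ s θ,
    fun i j => (h₁.contDiff_multiplier g₁ i j).add (h₂.contDiff_multiplier g₂ i j),
    fun i j => (h₁.contDiff_kernel g₁ i j).add (h₂.contDiff_kernel g₂ i j),
    fun s hs u => ?_, fun v hv => ?_, hM, hN⟩
  · rw [add_mulVec, dotProduct_add]
    exact add_nonneg (h₁.multiplier_nonneg zero_le_one u)
      (h₂.multiplier_nonneg (weight_nonneg s hs) u)
  · have hMc : ∀ {g : ℝ → ℝ} {M : ℝ → Matrix ι ι ℝ} {N : ℝ → ℝ → Matrix ι ι ℝ},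
        IsSosPair τ d g M N → ContDiff ℝ 1 g → Continuous fun s => v s ⬝ᵥ M s *ᵥ v s :=
      fun h hg => hv.dotProduct
        ((continuous_matrix fun i j => (h.contDiff_multiplier hg i j).continuous).matrix_mulVec hv)
    have hNc : ∀ {g : ℝ → ℝ} {M : ℝ → Matrix ι ι ℝ} {N : ℝ → ℝ → Matrix ι ι ℝ},
        IsSosPair τ d g M N → ContDiff ℝ 1 g →
          Continuous fun p : ℝ × ℝ => v p.1 ⬝ᵥ N p.1 p.2 *ᵥ v p.2 :=
      fun h hg => (hv.comp continuous_fst).dotProduct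
        (Continuous.matrix_mulVec (A := fun p : ℝ × ℝ => _)
          (continuous_matrix fun i j => (h.contDiff_kernel hg i j).continuous)
          (hv.comp continuous_snd))
    simp only [add_mulVec, dotProduct_add]
    rw [integral_add (hMc h₁ g₁).integrable_delay (hMc h₂ g₂).integrable_delay,
      integral_add (hNc h₁ g₁).integrable_delay_prod (hNc h₂ g₂).integrable_delay_prod,
      integral_prod _ (hNc h₁ g₁).integrable_delay_prod,
      integral_prod _ (hNc h₂ g₂).integrable_delay_prod]
    have p₁ := h₁.form_nonneg continuous_const (fun _ _ => zero_le_one) hv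
    have p₂ := h₂.form_nonneg g₂.continuous weight_nonneg hv
    linarith

theorem integrable_form_of_entries {X α β : Type*} [Fintype α] [Fintype β] [MeasurableSpace X]
    {ρ : Measure X} {L : X → Matrix α β ℝ} (hL : ∀ i j, Integrable (fun x => L x i j) ρ)
    {u : X → α → ℝ} {w : X → β → ℝ} {C : ℝ} (hu : ∀ i, AEStronglyMeasurable (fun x => u x i) ρ)
    (hw : ∀ j, AEStronglyMeasurable (fun x => w x j) ρ)
    (hC : ∀ i j, ∀ᵐ x ∂ρ, ‖u x i * w x j‖ ≤ C) :
    Integrable (fun x => u x ⬝ᵥ L x *ᵥ w x) ρ := by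
  have h : (fun x => u x ⬝ᵥ L x *ᵥ w x) =
      fun x => ∑ i, ∑ j, u x i * w x j * L x i j := by
    ext x
    simp only [dotProduct, mulVec, Finset.mul_sum]
    exact Finset.sum_congr rfl fun i _ => Finset.sum_congr rfl fun j _ => by ring
  rw [h]
  exact integrable_finsetSum _ fun i _ => integrable_finsetSum _ fun j _ =>
    (hL i j).bdd_mul ((hu i).mul (hw j)) (hC i j)

theorem integrable_form_delay {τ : ℝ} {α β : Type*} [Fintype α] [Fintype β]
    {L : ℝ → Matrix α β ℝ} (hL : ∀ i j, Integrable (fun s => L s i j) (delayMeasure τ))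
    {u : ℝ → α → ℝ} {w : ℝ → β → ℝ} (hu : Continuous u) (hw : Continuous w) :
    Integrable (fun s => u s ⬝ᵥ L s *ᵥ w s) (delayMeasure τ) := by
  have hui : ∀ i, Continuous fun s => u s i := fun i => (continuous_apply i).comp hu
  have hwj : ∀ j, Continuous fun s => w s j := fun j => (continuous_apply j).comp hw
  obtain ⟨C, -, hC⟩ := exists_norm_le_of_continuous τ hu
  obtain ⟨c, -, hc⟩ := exists_norm_le_of_continuous τ hw
  refine integrable_form_of_entries hL (C := C * c) (fun i => (hui i).aestronglyMeasurable)
    (fun j => (hwj j).aestronglyMeasurable) fun i j => ?_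
  filter_upwards [ae_mem_delayInterval τ] with s hs
  rw [norm_mul]
  exact mul_le_mul ((norm_le_pi_norm _ i).trans (hC s hs)) ((norm_le_pi_norm _ j).trans (hc s hs))
    (norm_nonneg _) ((norm_nonneg _).trans (hC s hs))

theorem ae_mem_delayInterval_prod (τ : ℝ) : ∀ᵐ p ∂((delayMeasure τ).prod (delayMeasure τ)),
    p.1 ∈ Icc (-τ) (0 : ℝ) ∧ p.2 ∈ Icc (-τ) (0 : ℝ) := by
  rw [Measure.prod_restrict]
  exact ae_restrict_mem (measurableSet_Icc.prod measurableSet_Icc)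

theorem integrable_form_delay_prod {τ : ℝ} {α β : Type*} [Fintype α] [Fintype β]
    {L : ℝ → ℝ → Matrix α β ℝ} (hL : ∀ i j, Integrable (fun p : ℝ × ℝ => L p.1 p.2 i j)
      ((delayMeasure τ).prod (delayMeasure τ)))
    {u : ℝ → α → ℝ} {w : ℝ → β → ℝ} (hu : Continuous u) (hw : Continuous w) :
    Integrable (fun p : ℝ × ℝ => u p.1 ⬝ᵥ L p.1 p.2 *ᵥ w p.2)
      ((delayMeasure τ).prod (delayMeasure τ)) := by
  have hui : ∀ i, Continuous fun p : ℝ × ℝ => u p.1 i := fun i =>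
    (continuous_apply i).comp (hu.comp continuous_fst)
  have hwj : ∀ j, Continuous fun p : ℝ × ℝ => w p.2 j := fun j =>
    (continuous_apply j).comp (hw.comp continuous_snd)
  obtain ⟨C, -, hC⟩ := exists_norm_le_of_continuous τ hu
  obtain ⟨c, -, hc⟩ := exists_norm_le_of_continuous τ hw
  refine integrable_form_of_entries (u := fun p : ℝ × ℝ => u p.1) (w := fun p : ℝ × ℝ => w p.2)
    hL (C := C * c) (fun i => (hui i).aestronglyMeasurable)
    (fun j => (hwj j).aestronglyMeasurable) fun i j => ?_
  filter_upwards [ae_mem_delayInterval_prod τ] with p hp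
  rw [norm_mul]
  exact mul_le_mul ((norm_le_pi_norm _ i).trans (hC _ hp.1))
    ((norm_le_pi_norm _ j).trans (hc _ hp.2))
    (norm_nonneg _) ((norm_nonneg _).trans (hC _ hp.1))

/-- Spacing functions do not contribute to the quadratic form. -/
theorem Theta.form_eq_zero {μ ν : Type} [Fintype μ] [Fintype ν] {τ : ℝ} (hτ : 0 < τ)
    {P : (ℝ → Matrix (μ ⊕ ν) (μ ⊕ ν) ℝ) × (ℝ → ℝ → Matrix (μ ⊕ ν) (μ ⊕ ν) ℝ)}
    (h : P ∈ Theta τ) (x : μ → ℝ) {z : ℝ → ν → ℝ} (hz : Continuous z) :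
    Integrable (fun s => Sum.elim x (z s) ⬝ᵥ P.1 s *ᵥ Sum.elim x (z s)) (delayMeasure τ) ∧
    Integrable (fun p : ℝ × ℝ => Sum.elim x (z p.1) ⬝ᵥ P.2 p.1 p.2 *ᵥ Sum.elim x (z p.2))
      ((delayMeasure τ).prod (delayMeasure τ)) ∧
    (∫ s, Sum.elim x (z s) ⬝ᵥ P.1 s *ᵥ Sum.elim x (z s) ∂(delayMeasure τ))
      + ∫ p, Sum.elim x (z p.1) ⬝ᵥ P.2 p.1 p.2 *ᵥ Sum.elim x (z p.2)
        ∂((delayMeasure τ).prod (delayMeasure τ)) = 0 := by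
  obtain ⟨K, L₁₁, L₁₂, L₂₁, hK, h₁₁, h₁₂, h₂₁, hK0, hF, hH⟩ := h
  simp only [restrict_delaySquare] at h₁₁ h₁₂ h₂₁ hH
  have iK : ∀ i j, Integrable (fun s => K s i j) (delayMeasure τ) := fun i j =>
    MemLp.integrable (μ := delayMeasure τ) (by norm_num) (hK i j)
  have i₁₁ := fun i j => (h₁₁ i j).integrable (by norm_num)
  have i₁₂ := fun i j => (h₁₂ i j).integrable (by norm_num)
  have i₂₁ := fun i j => (h₂₁ i j).integrable (by norm_num)
  have f₁₁ := integrable_form_delay_prod i₁₁ (continuous_const (y := x)) (continuous_const (y := x))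
  have f₁₂ := integrable_form_delay_prod i₁₂ (continuous_const (y := x)) hz
  have f₂₁ := integrable_form_delay_prod i₂₁ hz (continuous_const (y := x))
  have fK := integrable_form_delay iK (continuous_const (y := x)) (continuous_const (y := x))
  -- The kernels are only square integrable, so their slices are integrable for almost every value
  -- of the other variable.
  have sl : ∀ {α β : Type} [Fintype α] [Fintype β] {L : ℝ → ℝ → Matrix α β ℝ},
      (∀ i j, Integrable (fun p : ℝ × ℝ => L p.1 p.2 i j)
        ((delayMeasure τ).prod (delayMeasure τ))) →
      (∀ᵐ θ ∂(delayMeasure τ), ∀ i j, Integrable (fun s => L s θ i j) (delayMeasure τ)) ∧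
      ∀ᵐ s ∂(delayMeasure τ), ∀ i j, Integrable (fun θ => L s θ i j) (delayMeasure τ) := by
    intro α β _ _ L hL
    constructor
    · simp only [ae_all_iff]
      exact fun i j => (hL i j).prod_left_ae
    · simp only [ae_all_iff]
      exact fun i j => (hL i j).prod_right_ae
  have c₁₁ : x ⬝ᵥ (matIntegral τ fun t => matIntegral τ fun η => L₁₁ η t) *ᵥ x
      = ∫ p, x ⬝ᵥ L₁₁ p.1 p.2 *ᵥ x ∂((delayMeasure τ).prod (delayMeasure τ)) := by
    rw [dotProduct_matIntegral_mulVec (L := fun t => matIntegral τ fun η => L₁₁ η t)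
        fun i j => (i₁₁ i j).integral_prod_right, integral_prod_symm _ f₁₁]
    refine integral_congr_ae ((sl i₁₁).1.mono fun t ht => ?_)
    exact dotProduct_matIntegral_mulVec ht x x
  have c₁₂ : (fun θ => x ⬝ᵥ (matIntegral τ fun η => L₁₂ η θ) *ᵥ z θ) =ᵐ[delayMeasure τ]
      fun θ => ∫ s, x ⬝ᵥ L₁₂ s θ *ᵥ z θ ∂(delayMeasure τ) :=
    (sl i₁₂).1.mono fun t ht => dotProduct_matIntegral_mulVec ht x (z t)
  have c₂₁ : (fun s => z s ⬝ᵥ (matIntegral τ fun η => L₂₁ s η) *ᵥ x) =ᵐ[delayMeasure τ]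
      fun s => ∫ θ, z s ⬝ᵥ L₂₁ s θ *ᵥ x ∂(delayMeasure τ) :=
    (sl i₂₁).2.mono fun t ht => dotProduct_matIntegral_mulVec ht (z t) x
  have cK : ∫ s, x ⬝ᵥ K s *ᵥ x ∂(delayMeasure τ) = 0 := by
    rw [← dotProduct_matIntegral_mulVec iK, hK0]; simp
  set c := ∫ p, x ⬝ᵥ L₁₁ p.1 p.2 *ᵥ x ∂((delayMeasure τ).prod (delayMeasure τ)) with hc
  have eF : (fun s => Sum.elim x (z s) ⬝ᵥ P.1 s *ᵥ Sum.elim x (z s)) =ᵐ[delayMeasure τ]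
      ((fun s => x ⬝ᵥ K s *ᵥ x) + fun _ => τ⁻¹ * c)
        + (fun θ => ∫ s, x ⬝ᵥ L₁₂ s θ *ᵥ z θ ∂(delayMeasure τ))
        + fun s => ∫ θ, z s ⬝ᵥ L₂₁ s θ *ᵥ x ∂(delayMeasure τ) := by
    filter_upwards [hF, c₁₂, c₂₁] with s h1 h2 h3
    simp only [Pi.add_apply]
    rw [h1, ← h2, ← h3, ← c₁₁, fromBlocks_mulVec, sumElim_dotProduct_sumElim]
    simp only [Sum.elim_comp_inl, Sum.elim_comp_inr, dotProduct_add, add_mulVec, smul_mulVec,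
      dotProduct_smul, smul_eq_mul, zero_mulVec, dotProduct_zero]
    ring
  have eH : (fun p : ℝ × ℝ => Sum.elim x (z p.1) ⬝ᵥ P.2 p.1 p.2 *ᵥ Sum.elim x (z p.2))
      =ᵐ[(delayMeasure τ).prod (delayMeasure τ)]
      -((fun p : ℝ × ℝ => x ⬝ᵥ L₁₁ p.1 p.2 *ᵥ x) + (fun p => x ⬝ᵥ L₁₂ p.1 p.2 *ᵥ z p.2)
        + fun p => z p.1 ⬝ᵥ L₂₁ p.1 p.2 *ᵥ x) := by
    filter_upwards [hH] with p h1
    simp only [Pi.add_apply, Pi.neg_apply]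
    rw [h1, neg_mulVec, dotProduct_neg, fromBlocks_mulVec, sumElim_dotProduct_sumElim]
    simp only [Sum.elim_comp_inl, Sum.elim_comp_inr, dotProduct_add, zero_mulVec, dotProduct_zero]
    ring
  have jc : Integrable (fun _ : ℝ => τ⁻¹ * c) (delayMeasure τ) := integrable_const _
  have j₁₂ := f₁₂.integral_prod_right
  have j₂₁ := f₂₁.integral_prod_left
  refine ⟨(((fK.add jc).add j₁₂).add j₂₁).congr eF.symm,
    (((f₁₁.add f₁₂).add f₂₁).neg).congr eH.symm, ?_⟩
  -- K integrates to zero, the constant τ⁻¹c integrates over length τ to c, and by Fubini the L₁₂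
  -- and L₂₁ terms of F equal those of -H.
  rw [integral_congr_ae eF, integral_congr_ae eH, integral_add' ((fK.add jc).add j₁₂) j₂₁,
    integral_add' (fK.add jc) j₁₂, integral_add' fK jc, integral_neg',
    integral_add' (f₁₁.add f₁₂) f₂₁, integral_add' f₁₁ f₁₂, cK, ← hc,
    integral_prod_symm _ f₁₂, integral_prod _ f₂₁, integral_const, measureReal_delay hτ.le,
    smul_eq_mul, mul_inv_cancel_left₀ hτ.ne']
  ring

/-- The form of a pair that belongs to `Ξ` up to spacing functions and a scalar factor. -/
theorem form_nonneg_of_mem_Xi {μ ν : Type} [Fintype μ] [Fintype ν] [DecidableEq μ]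
    [DecidableEq ν] {τ : ℝ} (hτ : 0 < τ) {d : ℕ}
    {F : ℝ → Matrix (μ ⊕ ν) (μ ⊕ ν) ℝ} {H : ℝ → ℝ → Matrix (μ ⊕ ν) (μ ⊕ ν) ℝ}
    (hFH : (F, H) ∈ Theta τ)
    {P : (ℝ → Matrix (μ ⊕ ν) (μ ⊕ ν) ℝ) × (ℝ → ℝ → Matrix (μ ⊕ ν) (μ ⊕ ν) ℝ)}
    (hP : P ∈ Xi τ d) {A : ℝ → Matrix (μ ⊕ ν) (μ ⊕ ν) ℝ}
    {B : ℝ → ℝ → Matrix (μ ⊕ ν) (μ ⊕ ν) ℝ} (hA : Continuous A)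
    (hB : Continuous (Function.uncurry B)) (c : ℝ)
    (hPA : ∀ᵐ s ∂(delayMeasure τ), P.1 s = c • (A s + F s))
    (hPB : ∀ᵐ p ∂((delayMeasure τ).prod (delayMeasure τ)), P.2 p.1 p.2 = c • (B p.1 p.2 + H p.1 p.2))
    (x : μ → ℝ) {z : ℝ → ν → ℝ} (hz : Continuous z) :
    0 ≤ c * ((∫ s, Sum.elim x (z s) ⬝ᵥ A s *ᵥ Sum.elim x (z s) ∂(delayMeasure τ))
      + ∫ s, ∫ θ, Sum.elim x (z s) ⬝ᵥ B s θ *ᵥ Sum.elim x (z θ)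
        ∂(delayMeasure τ) ∂(delayMeasure τ)) := by
  obtain ⟨M, N, -, -, -, hpos, hM, hN⟩ := Xi.exists_contDiff hP
  obtain ⟨iF, iH, h0⟩ := Theta.form_eq_zero hτ hFH x hz
  have hv : Continuous fun s => Sum.elim x (z s) := by
    refine continuous_pi fun i => ?_
    cases i with
    | inl i => exact continuous_const
    | inr j => exact (continuous_apply j).comp hz
  have hAc : Continuous fun s => Sum.elim x (z s) ⬝ᵥ A s *ᵥ Sum.elim x (z s) :=
    hv.dotProduct (hA.matrix_mulVec hv)
  have hBc : Continuous fun p : ℝ × ℝ =>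
      Sum.elim x (z p.1) ⬝ᵥ B p.1 p.2 *ᵥ Sum.elim x (z p.2) :=
    (hv.comp continuous_fst).dotProduct (hB.matrix_mulVec (hv.comp continuous_snd))
  have e1 : (fun s => Sum.elim x (z s) ⬝ᵥ M s *ᵥ Sum.elim x (z s)) =ᵐ[delayMeasure τ]
      fun s => c * (Sum.elim x (z s) ⬝ᵥ A s *ᵥ Sum.elim x (z s)
        + Sum.elim x (z s) ⬝ᵥ F s *ᵥ Sum.elim x (z s)) := by
    filter_upwards [hM, hPA] with s h1 h2
    rw [← h1, h2, smul_mulVec, dotProduct_smul, add_mulVec, dotProduct_add, smul_eq_mul]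
  have e2 : (fun p : ℝ × ℝ => Sum.elim x (z p.1) ⬝ᵥ N p.1 p.2 *ᵥ Sum.elim x (z p.2))
      =ᵐ[(delayMeasure τ).prod (delayMeasure τ)]
      fun p => c * (Sum.elim x (z p.1) ⬝ᵥ B p.1 p.2 *ᵥ Sum.elim x (z p.2)
        + Sum.elim x (z p.1) ⬝ᵥ H p.1 p.2 *ᵥ Sum.elim x (z p.2)) := by
    filter_upwards [hN, hPB] with s h1 h2
    rw [← h1, h2, smul_mulVec, dotProduct_smul, add_mulVec, dotProduct_add, smul_eq_mul]
  have h := hpos _ hv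
  rw [integral_congr_ae e1, integral_congr_ae e2, integral_const_mul, integral_const_mul,
    integral_add hAc.integrable_delay iF, integral_add hBc.integrable_delay_prod iH,
    integral_prod _ hBc.integrable_delay_prod] at h
  refine h.trans (le_of_eq ?_)
  simp only at h0 ⊢
  linear_combination c * h0

end XiTheta

/-! ### Smooth representatives of the multiplier and the kernel -/

section Representatives

variable {n : ℕ}

theorem matDeriv_congr {α β : Type*} {f g : ℝ → Matrix α β ℝ} {s : ℝ}
    (h : f =ᶠ[nhds s] g) : matDeriv f s = matDeriv g s := by
  ext i j
  exact Filter.EventuallyEq.deriv_eq (h.mono fun σ hσ => congrArg (fun A : Matrix α β ℝ => A i j) hσ)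

/-- A continuous symmetric multiplier that agrees almost everywhere with a `C¹` function on the
interval agrees there with a symmetric `C¹` function. -/
theorem exists_symmetric_extension {τ : ℝ} (hτ : 0 < τ) {S W : ℝ → Matrix (Fin n) (Fin n) ℝ}
    (hS : ∀ i j, ContinuousOn (fun s => S s i j) (Icc (-τ) 0))
    (hSsymm : ∀ s ∈ Icc (-τ) 0, (S s).IsSymm) (hW : ∀ i j, ContDiff ℝ 1 fun s => W s i j)
    (hSW : ∀ᵐ s ∂(delayMeasure τ), S s = W s) :
    ∃ T : ℝ → Matrix (Fin n) (Fin n) ℝ, (∀ i j, ContDiff ℝ 1 fun s => T s i j) ∧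
      (∀ s, (T s)ᵀ = T s) ∧ (∀ s ∈ Icc (-τ) 0, T s = S s) ∧
      ∀ s ∈ Icc (-τ) 0, S s = W s := by
  have hcl : Icc (-τ) (0 : ℝ) ⊆ closure (interior (Icc (-τ) 0)) := by
    rw [interior_Icc, closure_Ioo (by linarith)]
  -- Two continuous functions equal almost everywhere agree on a set contained in the closure of its
  -- interior.
  have heq : ∀ s ∈ Icc (-τ) 0, S s = W s := fun s hs => by
    ext i j
    exact Measure.eqOn_of_ae_eq (hSW.mono fun s hs => by simp only [hs]) (hS i j)
      (hW i j).continuous.continuousOn hcl hs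
  -- W need not be symmetric off the interval. Averaging with the transpose enforces symmetry
  -- everywhere and changes nothing where W equals S.
  refine ⟨fun s => (1 / 2 : ℝ) • (W s + (W s)ᵀ), fun i j => ?_, fun s => ?_, fun s hs => ?_, heq⟩
  · simp only [Matrix.smul_apply, Matrix.add_apply, transpose_apply]
    exact ((hW i j).add (hW j i)).const_smul (1 / 2 : ℝ)
  · rw [transpose_smul, transpose_add, transpose_transpose, add_comm]
  · beta_reduce
    rw [← heq s hs, (hSsymm s hs).eq, ← two_smul ℝ (S s), smul_smul]
    norm_num

theorem exists_symmetric_kernel_extension {τ : ℝ} (hτ : 0 < τ)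
    {R W : ℝ → ℝ → Matrix (Fin n) (Fin n) ℝ}
    (hR : ∀ i j, ContinuousOn (fun p : ℝ × ℝ => R p.1 p.2 i j) (Icc (-τ) 0 ×ˢ Icc (-τ) 0))
    (hRsymm : ∀ s ∈ Icc (-τ) 0, ∀ θ ∈ Icc (-τ) 0, R s θ = (R θ s)ᵀ)
    (hW : ∀ i j, ContDiff ℝ 1 fun p : ℝ × ℝ => W p.1 p.2 i j)
    (hRW : ∀ᵐ p ∂((delayMeasure τ).prod (delayMeasure τ)), R p.1 p.2 = W p.1 p.2) :
    ∃ T : ℝ → ℝ → Matrix (Fin n) (Fin n) ℝ,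
      (∀ i j, ContDiff ℝ 1 fun p : ℝ × ℝ => T p.1 p.2 i j) ∧ (∀ s θ, (T θ s)ᵀ = T s θ) ∧
      ∀ s ∈ Icc (-τ) 0, ∀ θ ∈ Icc (-τ) 0, T s θ = R s θ := by
  have hcl : Icc (-τ) (0 : ℝ) ×ˢ Icc (-τ) (0 : ℝ)
      ⊆ closure (interior (Icc (-τ) 0 ×ˢ Icc (-τ) 0)) := by
    rw [interior_prod_eq, closure_prod_eq, interior_Icc, closure_Ioo (by linarith)]
  rw [Measure.prod_restrict] at hRW
  have heq : ∀ s ∈ Icc (-τ) 0, ∀ θ ∈ Icc (-τ) 0, R s θ = W s θ := fun s hs θ hθ => by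
    ext i j
    exact Measure.eqOn_of_ae_eq (hRW.mono fun s hs => by simp only [hs]) (hR i j)
      (hW i j).continuous.continuousOn hcl (show (s, θ) ∈ _ from ⟨hs, hθ⟩)
  refine ⟨fun s θ => (1 / 2 : ℝ) • (W s θ + (W θ s)ᵀ), fun i j => ?_, fun s θ => ?_,
    fun s hs θ hθ => ?_⟩
  · simp only [Matrix.smul_apply, Matrix.add_apply, transpose_apply]
    exact ((hW i j).add ((hW j i).comp (contDiff_snd.prodMk contDiff_fst))).const_smul (1 / 2 : ℝ)
  · rw [transpose_smul, transpose_add, transpose_transpose, add_comm]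
  · beta_reduce
    rw [← heq s hs θ hθ, ← heq θ hθ s hs, ← hRsymm s hs θ hθ, ← two_smul ℝ (R s θ), smul_smul]
    norm_num

/-- Expansion in matrix units reduces continuity and differentiability of operator-valued functions
to those of the entries. -/
theorem toEuclideanCLM_eq_sum (A : Matrix (Fin n) (Fin n) ℝ) :
    toEuclideanCLM (𝕜 := ℝ) A =
      ∑ i, ∑ j, A i j • toEuclideanCLM (𝕜 := ℝ) (single i j (1 : ℝ)) := by
  conv_lhs => rw [matrix_eq_sum_single A]
  simp_rw [map_sum, ← map_smul, smul_single, smul_eq_mul, mul_one]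

theorem continuous_toEuclideanCLM :
    Continuous (toEuclideanCLM (𝕜 := ℝ) (n := Fin n)) := by
  refine Continuous.congr ?_ fun A => (toEuclideanCLM_eq_sum A).symm
  exact continuous_finsetSum _ fun i _ => continuous_finsetSum _ fun j _ =>
    (continuous_id.matrix_elem i j).smul continuous_const

theorem hasDerivAt_toEuclideanCLM {f : ℝ → Matrix (Fin n) (Fin n) ℝ}
    {f' : Matrix (Fin n) (Fin n) ℝ} {s : ℝ}
    (h : ∀ i j, HasDerivAt (fun σ => f σ i j) (f' i j) s) :
    HasDerivAt (fun σ => toEuclideanCLM (𝕜 := ℝ) (f σ)) (toEuclideanCLM (𝕜 := ℝ) f') s := by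
  simp_rw [fun σ => toEuclideanCLM_eq_sum (f σ)]
  rw [toEuclideanCLM_eq_sum f']
  exact HasDerivAt.fun_sum fun i _ => HasDerivAt.fun_sum fun j _ => (h i j).smul_const
    (toEuclideanCLM (𝕜 := ℝ) (single i j (1 : ℝ)))

theorem inner_toEuclideanCLM (A : Matrix (Fin n) (Fin n) ℝ) (x y : EuclideanSpace ℝ (Fin n)) :
    inner ℝ x (toEuclideanCLM (𝕜 := ℝ) A y) = x.ofLp ⬝ᵥ A *ᵥ y.ofLp := by
  rw [EuclideanSpace.inner_eq_star_dotProduct, star_trivial, ofLp_toEuclideanCLM, dotProduct_comm]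

theorem norm_sq_eq_dotProduct (x : EuclideanSpace ℝ (Fin n)) :
    ‖x‖ ^ 2 = x.ofLp ⬝ᵥ x.ofLp := by
  rw [← real_inner_self_eq_norm_sq, EuclideanSpace.inner_eq_star_dotProduct, star_trivial]

theorem contDiff_partial_left {f : ℝ × ℝ → ℝ} (hf : ContDiff ℝ 1 f) :
    (∀ s θ, HasDerivAt (fun σ => f (σ, θ)) (deriv (fun σ => f (σ, θ)) s) s) ∧
      Continuous fun p : ℝ × ℝ => deriv (fun σ => f (σ, p.2)) p.1 := by
  have hd : ∀ s θ, HasDerivAt (fun σ => f (σ, θ)) (fderiv ℝ f (s, θ) (1, 0)) s := fun s θ =>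
    ((hf.differentiable one_ne_zero (s, θ)).hasFDerivAt).comp_hasDerivAt s
      ((hasDerivAt_id s).prodMk (hasDerivAt_const s θ))
  refine ⟨fun s θ => (hd s θ).differentiableAt.hasDerivAt, ?_⟩
  simp_rw [fun p : ℝ × ℝ => (hd p.1 p.2).deriv]
  exact (hf.continuous_fderiv one_ne_zero).clm_apply continuous_const

end Representatives

/-! ### Verification of the operator-valued certificate -/

section Certificate

variable {n : ℕ} {τ ε : ℝ} {A₀ A₁ : Matrix (Fin n) (Fin n) ℝ}
  {S : ℝ → Matrix (Fin n) (Fin n) ℝ} {R : ℝ → ℝ → Matrix (Fin n) (Fin n) ℝ}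

theorem form_dualM (x z : Fin n → ℝ) (s : ℝ) :
    Sum.elim x z ⬝ᵥ dualM τ ε S R 0 s *ᵥ Sum.elim x z =
      τ * (x ⬝ᵥ R 0 0 *ᵥ x) + τ * (x ⬝ᵥ S 0 *ᵥ x) + τ * (x ⬝ᵥ R 0 s *ᵥ z)
        + τ * (z ⬝ᵥ R s 0 *ᵥ x) + τ * (z ⬝ᵥ S s *ᵥ z) - ε * (x ⬝ᵥ x + z ⬝ᵥ z) := by
  rw [dualM, Pi.zero_apply, add_zero, sub_mulVec, smul_mulVec, one_mulVec, dotProduct_sub,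
    dotProduct_smul, sumElim_dotProduct_sumElim, fromBlocks_mulVec, sumElim_dotProduct_sumElim]
  simp only [Sum.elim_comp_inl, Sum.elim_comp_inr, dotProduct_add, add_mulVec, smul_mulVec,
    dotProduct_smul, smul_eq_mul]
  ring

theorem form_dualN (x z w : Fin n → ℝ) (s θ : ℝ) :
    Sum.elim x z ⬝ᵥ dualN R 0 s θ *ᵥ Sum.elim x w = z ⬝ᵥ R s θ *ᵥ w := by
  rw [dualN, Pi.zero_apply, Pi.zero_apply, add_zero, fromBlocks_mulVec, sumElim_dotProduct_sumElim]
  simp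

theorem form_dualE (x : Fin n ⊕ Fin n → ℝ) (z w : Fin n → ℝ) (s θ : ℝ) :
    Sum.elim x z ⬝ᵥ dualE R 0 s θ *ᵥ Sum.elim x w = z ⬝ᵥ dualG R s θ *ᵥ w := by
  rw [dualE, Pi.zero_apply, Pi.zero_apply, add_zero, fromBlocks_mulVec, sumElim_dotProduct_sumElim]
  simp

theorem form_dualD (x u z : Fin n → ℝ) (s : ℝ) :
    Sum.elim (Sum.elim x u) z ⬝ᵥ dualD τ ε A₀ A₁ S R 0 s *ᵥ Sum.elim (Sum.elim x u) z =
      2 * (x ⬝ᵥ dualS11 τ A₀ A₁ S R *ᵥ x) + 2 * (x ⬝ᵥ dualS12 τ A₁ S *ᵥ u)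
        - u ⬝ᵥ S (-τ) *ᵥ u + 2 * τ * (x ⬝ᵥ dualS13 τ A₀ A₁ R s *ᵥ z)
        + τ * (z ⬝ᵥ matDeriv S s *ᵥ z) + ε * (x ⬝ᵥ x + z ⬝ᵥ z) := by
  rw [dualD, Pi.zero_apply, add_zero, fromBlocks_mulVec, sumElim_dotProduct_sumElim]
  simp only [Sum.elim_comp_inl, Sum.elim_comp_inr, dotProduct_add, add_mulVec, smul_mulVec,
    dotProduct_smul, smul_eq_mul, dotProduct_transpose_mulVec, one_mulVec]
  rw [dualD0, dualV, fromBlocks_mulVec, sumElim_dotProduct_sumElim, fromRows_mulVec,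
    sumElim_dotProduct_sumElim]
  simp only [Sum.elim_comp_inl, Sum.elim_comp_inr, dotProduct_add, add_mulVec, smul_mulVec,
    dotProduct_smul, smul_eq_mul, dotProduct_transpose_mulVec, one_mulVec, zero_mulVec,
    dotProduct_zero, dualS22, neg_mulVec, dotProduct_neg]
  ring

/-- This turns the transposed derivative in S₁₃(s) into ∂R/∂θ at (0, s), the term that arises when
R(s,0)x is differentiated and paired with w(s). -/
theorem transpose_matDeriv_left (hRs : ∀ s θ, (R θ s)ᵀ = R s θ) (s θ : ℝ) :
    (matDeriv (fun σ => R σ θ) s)ᵀ = matDeriv (fun ϑ => R θ ϑ) s := by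
  ext i j
  simp only [transpose_apply, matDeriv, of_apply]
  congr 1; ext σ
  rw [← hRs θ σ, transpose_apply]

theorem dotProduct_mulVec_comm_of_transpose {A B : Matrix (Fin n) (Fin n) ℝ} (h : Aᵀ = B)
    (x y : Fin n → ℝ) : x ⬝ᵥ A *ᵥ y = y ⬝ᵥ B *ᵥ x := by
  rw [← h, dotProduct_transpose_mulVec]

/-- The forms are those of the data with spacing functions set to zero, so they can be matched with
the certificate term by term. -/
theorem isDualCertificate_of_forms
    (hS : ∀ i j, ContDiff ℝ 1 fun s => S s i j) (hSs : ∀ s, (S s)ᵀ = S s)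
    (hR : ∀ i j, ContDiff ℝ 1 fun p : ℝ × ℝ => R p.1 p.2 i j) (hRs : ∀ s θ, (R θ s)ᵀ = R s θ)
    (hle : ∀ s ∈ Icc (-τ) 0, ∀ u, ε * (u ⬝ᵥ u) ≤ τ * (u ⬝ᵥ S s *ᵥ u))
    (hM : ∀ (x : Fin n → ℝ) (z : ℝ → Fin n → ℝ), Continuous z →
      0 ≤ (∫ s, Sum.elim x (z s) ⬝ᵥ dualM τ ε S R 0 s *ᵥ Sum.elim x (z s) ∂(delayMeasure τ))
        + ∫ s, ∫ θ, Sum.elim x (z s) ⬝ᵥ dualN R 0 s θ *ᵥ Sum.elim x (z θ)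
          ∂(delayMeasure τ) ∂(delayMeasure τ))
    (hD : ∀ (x : Fin n ⊕ Fin n → ℝ) (z : ℝ → Fin n → ℝ), Continuous z →
      (∫ s, Sum.elim x (z s) ⬝ᵥ dualD τ ε A₀ A₁ S R 0 s *ᵥ Sum.elim x (z s) ∂(delayMeasure τ))
        + ∫ s, ∫ θ, Sum.elim x (z s) ⬝ᵥ dualE R 0 s θ *ᵥ Sum.elim x (z θ)
          ∂(delayMeasure τ) ∂(delayMeasure τ) ≤ 0) :
    IsDualCertificate τ ε (toEuclideanCLM (𝕜 := ℝ) A₀) (toEuclideanCLM (𝕜 := ℝ) A₁)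
      (fun s => toEuclideanCLM (𝕜 := ℝ) (S s)) (fun s => toEuclideanCLM (𝕜 := ℝ) (matDeriv S s))
      (fun s θ => toEuclideanCLM (𝕜 := ℝ) (R s θ))
      (fun s θ => toEuclideanCLM (𝕜 := ℝ) (matDeriv (fun σ => R σ θ) s))
      (fun s θ => toEuclideanCLM (𝕜 := ℝ) (matDeriv (fun ϑ => R s ϑ) θ)) := by
  have hRc : Continuous fun p : ℝ × ℝ => R p.1 p.2 :=
    continuous_matrix fun i j => (hR i j).continuous
  have hR₁c : Continuous fun p : ℝ × ℝ => matDeriv (fun σ => R σ p.2) p.1 :=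
    continuous_matrix fun i j => (contDiff_partial_left (hR i j)).2
  have hR₂c : Continuous fun p : ℝ × ℝ => matDeriv (fun ϑ => R p.1 ϑ) p.2 := by
    simp_rw [← transpose_matDeriv_left hRs]
    exact (hR₁c.comp continuous_swap).matrix_transpose
  have hker : ∀ {K : ℝ → ℝ → Matrix (Fin n) (Fin n) ℝ},
      (Continuous fun p : ℝ × ℝ => K p.1 p.2) →
      ∀ {z : ℝ → EuclideanSpace ℝ (Fin n)}, Continuous z →
      ∫ s, inner ℝ (z s) (∫ θ, toEuclideanCLM (𝕜 := ℝ) (K s θ) (z θ) ∂(delayMeasure τ))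
        ∂(delayMeasure τ)
      = ∫ s, ∫ θ, (z s).ofLp ⬝ᵥ K s θ *ᵥ (z θ).ofLp ∂(delayMeasure τ) ∂(delayMeasure τ) := by
    intro K hK z hz
    congr 1; ext s
    have hKs : Continuous fun θ => toEuclideanCLM (𝕜 := ℝ) (K s θ) :=
      continuous_toEuclideanCLM.comp (hK.comp (Continuous.prodMk_right s))
    rw [← integral_inner (integrable_clm_apply hKs hz.integrable_delay)]
    simp_rw [inner_toEuclideanCLM]
  have hof : ∀ {z : ℝ → EuclideanSpace ℝ (Fin n)}, Continuous z →
      Continuous fun s => (z s).ofLp := fun hz =>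
    (PiLp.continuous_ofLp 2 _).comp hz
  refine
    { hasDerivAt_S := fun s => hasDerivAt_toEuclideanCLM fun i j =>
        ((hS i j).differentiable one_ne_zero s).hasDerivAt
      continuous_S' := continuous_toEuclideanCLM.comp
        (continuous_matrix fun i j => (hS i j).continuous_deriv_one)
      continuous_R := continuous_toEuclideanCLM.comp hRc
      continuous_R₁ := continuous_toEuclideanCLM.comp hR₁c
      continuous_R₂ := continuous_toEuclideanCLM.comp hR₂c
      hasDerivAt_R := fun s θ => hasDerivAt_toEuclideanCLM fun i j =>
        (contDiff_partial_left (hR i j)).1 s θ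
      symm_S := fun s x y => ?_
      symm_R := fun s θ x y => ?_
      symm_R₁ := fun s θ x y => ?_
      le_S := fun s hs x => ?_
      coercive := fun x z hz => ?_
      dissipative := fun x u z hz => ?_ }
  · simp_rw [inner_toEuclideanCLM]
    exact dotProduct_mulVec_comm_of_transpose (hSs s) _ _
  · simp_rw [inner_toEuclideanCLM]
    exact dotProduct_mulVec_comm_of_transpose (hRs θ s) _ _
  · simp_rw [inner_toEuclideanCLM]
    exact dotProduct_mulVec_comm_of_transpose (transpose_matDeriv_left hRs s θ) _ _
  · rw [inner_toEuclideanCLM, norm_sq_eq_dotProduct]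
    exact hle s hs _
  · refine (hM x.ofLp (fun s => (z s).ofLp) (hof hz)).trans (le_of_eq ?_)
    rw [hker hRc hz]
    refine congrArg₂ (· + ·) (integral_congr_ae (Filter.Eventually.of_forall fun s => ?_)) ?_
    · simp only [form_dualM, inner_add_right, real_inner_smul_right, inner_toEuclideanCLM,
        norm_sq_eq_dotProduct]
      ring
    · simp only [form_dualN]
  · refine le_of_eq_of_le ?_ (hD (Sum.elim x.ofLp u.ofLp) (fun s => (z s).ofLp) (hof hz))
    simp_rw [← map_add]
    rw [hker (hR₁c.add hR₂c) hz]
    refine congrArg₂ (· + ·) (integral_congr_ae (Filter.Eventually.of_forall fun s => ?_)) ?_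
    · simp only [form_dualD, inner_add_right, real_inner_smul_right, inner_toEuclideanCLM,
        norm_sq_eq_dotProduct, ofLp_toEuclideanCLM, WithLp.ofLp_add, dualS11, dualS12, dualS13,
        add_mulVec, smul_mulVec, dotProduct_add, dotProduct_smul, smul_eq_mul, ← mulVec_mulVec,
        mulVec_add, transpose_matDeriv_left hRs]
      ring
    · simp only [form_dualE]
      rfl

end Certificate

/-! ### Passage to the smooth representatives -/

section SmoothRepresentatives

variable {n : ℕ} {τ ε : ℝ} {A₀ A₁ : Matrix (Fin n) (Fin n) ℝ}
  {S T : ℝ → Matrix (Fin n) (Fin n) ℝ} {R Q : ℝ → ℝ → Matrix (Fin n) (Fin n) ℝ}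

/-- Because this block is untouched by spacing functions, S and R can be read off from the lower
right blocks of M and N. -/
theorem Theta.ae_toBlocks₂₂ {μ ν : Type} {τ : ℝ}
    {P : (ℝ → Matrix (μ ⊕ ν) (μ ⊕ ν) ℝ) × (ℝ → ℝ → Matrix (μ ⊕ ν) (μ ⊕ ν) ℝ)}
    (h : P ∈ Theta τ) :
    (∀ᵐ s ∂(delayMeasure τ), (P.1 s).toBlocks₂₂ = 0) ∧
      ∀ᵐ p ∂((delayMeasure τ).prod (delayMeasure τ)), (P.2 p.1 p.2).toBlocks₂₂ = 0 := by
  obtain ⟨K, L₁₁, L₁₂, L₂₁, -, -, -, -, -, hF, hH⟩ := h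
  rw [restrict_delaySquare] at hH
  refine ⟨hF.mono fun s hs => ?_, hH.mono fun p hp => ?_⟩
  · rw [hs, toBlocks_fromBlocks₂₂]
  · rw [hp, fromBlocks_neg, toBlocks_fromBlocks₂₂, neg_zero]

theorem dualM_congr (hτ : 0 ≤ τ) (hT : ∀ s ∈ Icc (-τ) 0, T s = S s)
    (hQ : ∀ s ∈ Icc (-τ) 0, ∀ θ ∈ Icc (-τ) 0, Q s θ = R s θ)
    (F : ℝ → Matrix (Fin n ⊕ Fin n) (Fin n ⊕ Fin n) ℝ) {s : ℝ} (hs : s ∈ Icc (-τ) 0) :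
    dualM τ ε S R F s = dualM τ ε T Q 0 s + F s := by
  have h0 : (0 : ℝ) ∈ Icc (-τ) 0 := ⟨by linarith, le_rfl⟩
  rw [dualM, dualM, hT s hs, hT 0 h0, hQ 0 h0 0 h0, hQ 0 h0 s hs, hQ s hs 0 h0, Pi.zero_apply]
  abel

theorem dualN_congr (hQ : ∀ s ∈ Icc (-τ) 0, ∀ θ ∈ Icc (-τ) 0, Q s θ = R s θ)
    (H : ℝ → ℝ → Matrix (Fin n ⊕ Fin n) (Fin n ⊕ Fin n) ℝ) {s θ : ℝ} (hs : s ∈ Icc (-τ) 0)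
    (hθ : θ ∈ Icc (-τ) 0) : dualN R H s θ = dualN Q 0 s θ + H s θ := by
  rw [dualN, dualN, hQ s hs θ hθ, Pi.zero_apply, Pi.zero_apply, add_zero]

/-- Restricted to the open interval because `deriv` at an endpoint also depends on values outside,
where T and S may differ. -/
theorem dualD_congr (hτ : 0 ≤ τ) (hT : ∀ s ∈ Icc (-τ) 0, T s = S s)
    (hQ : ∀ s ∈ Icc (-τ) 0, ∀ θ ∈ Icc (-τ) 0, Q s θ = R s θ)
    (F : ℝ → Matrix ((Fin n ⊕ Fin n) ⊕ Fin n) ((Fin n ⊕ Fin n) ⊕ Fin n) ℝ) {s : ℝ}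
    (hs : s ∈ Ioo (-τ) 0) :
    dualD τ ε A₀ A₁ S R F s = dualD τ ε A₀ A₁ T Q 0 s + F s := by
  have h0 : (0 : ℝ) ∈ Icc (-τ) 0 := ⟨by linarith, le_rfl⟩
  have hτ' : -τ ∈ Icc (-τ) 0 := ⟨le_rfl, by linarith⟩
  have hs' := Ioo_subset_Icc_self hs
  have hnear : ∀ᶠ σ in nhds s, σ ∈ Icc (-τ) 0 := Icc_mem_nhds hs.1 hs.2
  have hdT : matDeriv T s = matDeriv S s := matDeriv_congr (hnear.mono hT)
  have hdQ : matDeriv (fun σ => Q σ 0) s = matDeriv (fun σ => R σ 0) s :=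
    matDeriv_congr (hnear.mono fun σ hσ => hQ σ hσ 0 h0)
  rw [dualD, dualD, dualD0, dualD0, dualV, dualV, dualS13, dualS13, dualS12, dualS12, dualS11,
    dualS11, dualS22, dualS22, hdT, hdQ, hT 0 h0, hT _ hτ', hQ 0 h0 0 h0, hQ _ hτ' 0 h0,
    hQ 0 h0 s hs', hQ _ hτ' s hs', Pi.zero_apply, add_zero]

theorem dualE_congr (hQ : ∀ s ∈ Icc (-τ) 0, ∀ θ ∈ Icc (-τ) 0, Q s θ = R s θ)
    (H : ℝ → ℝ → Matrix ((Fin n ⊕ Fin n) ⊕ Fin n) ((Fin n ⊕ Fin n) ⊕ Fin n) ℝ) {s θ : ℝ}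
    (hs : s ∈ Ioo (-τ) 0) (hθ : θ ∈ Ioo (-τ) 0) :
    dualE R H s θ = dualE Q 0 s θ + H s θ := by
  have hs' := Ioo_subset_Icc_self hs
  have hθ' := Ioo_subset_Icc_self hθ
  have h1 : matDeriv (fun σ => Q σ θ) s = matDeriv (fun σ => R σ θ) s := by
    refine matDeriv_congr ?_
    filter_upwards [Icc_mem_nhds hs.1 hs.2] with σ hσ using hQ σ hσ θ hθ'
  have h2 : matDeriv (fun ϑ => Q s ϑ) θ = matDeriv (fun ϑ => R s ϑ) θ := by
    refine matDeriv_congr ?_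
    filter_upwards [Icc_mem_nhds hθ.1 hθ.2] with σ hσ using hQ s hs' σ hσ
  rw [dualE, dualE, dualG, dualG, h1, h2, Pi.zero_apply, Pi.zero_apply, add_zero]

theorem ae_mem_Ioo_delay (τ : ℝ) : ∀ᵐ s ∂(delayMeasure τ), s ∈ Ioo (-τ) (0 : ℝ) := by
  rw [delayMeasure, ← restrict_Ioo_eq_restrict_Icc]
  exact ae_restrict_mem measurableSet_Ioo

theorem ae_mem_Ioo_delay_prod (τ : ℝ) : ∀ᵐ p ∂((delayMeasure τ).prod (delayMeasure τ)),
    p.1 ∈ Ioo (-τ) (0 : ℝ) ∧ p.2 ∈ Ioo (-τ) (0 : ℝ) := by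
  rw [delayMeasure, ← restrict_Ioo_eq_restrict_Icc, Measure.prod_restrict]
  exact ae_restrict_mem (measurableSet_Ioo.prod measurableSet_Ioo)

theorem continuous_dualM (hT : Continuous T) (hQ : Continuous (Function.uncurry Q)) :
    Continuous (dualM τ ε T Q 0) := by
  have h1 : Continuous (Q 0) := hQ.comp (Continuous.prodMk_right 0)
  have h2 : Continuous fun s => Q s 0 := hQ.comp (Continuous.prodMk_left 0)
  exact (((continuous_const.matrix_fromBlocks (h1.const_smul τ) (h2.const_smul τ)
    (hT.const_smul τ)).add continuous_const).sub continuous_const)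

theorem continuous_dualN (hQ : Continuous (Function.uncurry Q)) :
    Continuous (Function.uncurry (dualN Q 0)) :=
  (continuous_const.matrix_fromBlocks continuous_const continuous_const hQ).add continuous_const

theorem continuous_dualD (hT : ∀ i j, ContDiff ℝ 1 fun s => T s i j)
    (hQ : ∀ i j, ContDiff ℝ 1 fun p : ℝ × ℝ => Q p.1 p.2 i j) :
    Continuous (dualD τ ε A₀ A₁ T Q 0) := by
  have hQc : Continuous fun p : ℝ × ℝ => Q p.1 p.2 :=
    continuous_matrix fun i j => (hQ i j).continuous
  have h1 : ∀ s, Continuous (Q s) := fun s => hQc.comp (Continuous.prodMk_right s)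
  have h2 : Continuous (matDeriv T) := continuous_matrix fun i j => (hT i j).continuous_deriv_one
  have h3 : Continuous (matDeriv fun σ => Q σ 0) := continuous_matrix fun i j =>
    (contDiff_partial_left (hQ i j)).2.comp (Continuous.prodMk_left 0)
  have hV : Continuous (dualV τ A₀ A₁ Q) := by
    refine continuous_matrix fun i j => ?_
    cases i with
    | inl i =>
      exact (((continuous_const.matrix_mul (h1 0)).add
        (continuous_const.matrix_mul (h1 (-τ)))).add h3.matrix_transpose).matrix_elem i j
    | inr i => exact continuous_const
  exact (continuous_const.matrix_fromBlocks (hV.const_smul τ)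
    (hV.matrix_transpose.const_smul τ) ((h2.const_smul τ).add continuous_const)).add
    continuous_const

theorem continuous_dualE (hQ : ∀ i j, ContDiff ℝ 1 fun p : ℝ × ℝ => Q p.1 p.2 i j)
    (hQs : ∀ s θ, (Q θ s)ᵀ = Q s θ) : Continuous (Function.uncurry (dualE Q 0)) := by
  have h1 : Continuous fun p : ℝ × ℝ => matDeriv (fun σ => Q σ p.2) p.1 :=
    continuous_matrix fun i j => (contDiff_partial_left (hQ i j)).2
  have h2 : Continuous fun p : ℝ × ℝ => matDeriv (fun ϑ => Q p.1 ϑ) p.2 := by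
    simp_rw [← transpose_matDeriv_left hQs]
    exact (h1.comp continuous_swap).matrix_transpose
  exact (continuous_const.matrix_fromBlocks continuous_const continuous_const (h1.add h2)).add
    continuous_const

end SmoothRepresentatives

end

/-! ### The stability theorem -/

theorem mainTheorem5 (n d : ℕ) (τ ε : ℝ) (hτ : 0 < τ) (hε : 0 < ε)
    (A₀ A₁ : Matrix (Fin n) (Fin n) ℝ)
    (S : ℝ → Matrix (Fin n) (Fin n) ℝ) (R : ℝ → ℝ → Matrix (Fin n) (Fin n) ℝ)
    (hS : ∀ i j, MemW2 (delayInterval τ) (fun s => S s i j))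
    (hR : ∀ i j, MemW2 (delaySquare τ) (fun p : ℝ × ℝ => R p.1 p.2 i j))
    (hSsymm : ∀ s ∈ delayInterval τ, (S s).IsSymm)
    (hRsymm : ∀ s ∈ delayInterval τ, ∀ θ ∈ delayInterval τ, R s θ = (R θ s)ᵀ)
    (F₁ : ℝ → Matrix (Fin n ⊕ Fin n) (Fin n ⊕ Fin n) ℝ)
    (H₁ : ℝ → ℝ → Matrix (Fin n ⊕ Fin n) (Fin n ⊕ Fin n) ℝ)
    (F₂ : ℝ → Matrix ((Fin n ⊕ Fin n) ⊕ Fin n) ((Fin n ⊕ Fin n) ⊕ Fin n) ℝ)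
    (H₂ : ℝ → ℝ → Matrix ((Fin n ⊕ Fin n) ⊕ Fin n) ((Fin n ⊕ Fin n) ⊕ Fin n) ℝ)
    (hFH₁ : (F₁, H₁) ∈ Theta (μ := Fin n) (ν := Fin n) τ)
    (hFH₂ : (F₂, H₂) ∈ Theta (μ := Fin n ⊕ Fin n) (ν := Fin n) τ)
    (hMN : (dualM τ ε S R F₁, dualN R H₁) ∈ Xi τ d)
    (hDE : (-dualD τ ε A₀ A₁ S R F₂, -dualE R H₂) ∈ Xi τ d) :
    IsExponentiallyStable τ A₀ A₁ := by
  obtain ⟨M, N, hMs, hNs, hMpos, -, hM, hN⟩ := Xi.exists_contDiff hMN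
  obtain ⟨hF, hH⟩ := Theta.ae_toBlocks₂₂ hFH₁
  -- The lower right block of M is τS - εI, solved here for S.
  have hSM : ∀ᵐ s ∂(delayMeasure τ), S s = τ⁻¹ • ((M s).toBlocks₂₂ + ε • 1) := by
    filter_upwards [hM, hF] with s h1 h2
    rw [← h1]
    ext i j
    have h3 : F₁ s (Sum.inr i) (Sum.inr j) = 0 := congrFun (congrFun h2 i) j
    simp only [dualM, toBlocks₂₂, Matrix.smul_apply, Matrix.add_apply, Matrix.sub_apply, of_apply,
      fromBlocks_apply₂₂, h3, smul_eq_mul, one_apply, Sum.inr.injEq]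
    field_simp
    ring
  have hRN : ∀ᵐ p ∂((delayMeasure τ).prod (delayMeasure τ)),
      R p.1 p.2 = (N p.1 p.2).toBlocks₂₂ := by
    filter_upwards [hN, hH] with p h1 h2
    rw [← h1]
    ext i j
    have h3 : H₁ p.1 p.2 (Sum.inr i) (Sum.inr j) = 0 := congrFun (congrFun h2 i) j
    simp only [dualN, toBlocks₂₂, Matrix.add_apply, of_apply, fromBlocks_apply₂₂, h3, add_zero]
  obtain ⟨T, hTd, hTs, hTS, hSW⟩ := exists_symmetric_extension hτ (fun i j => (hS i j).1) hSsymm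
    (W := fun s => τ⁻¹ • ((M s).toBlocks₂₂ + ε • 1))
    (fun i j => by
      simp only [Matrix.smul_apply, Matrix.add_apply]
      exact ((hMs (Sum.inr i) (Sum.inr j)).add contDiff_const).const_smul τ⁻¹) hSM
  obtain ⟨Q, hQd, hQs, hQR⟩ := exists_symmetric_kernel_extension hτ (fun i j => (hR i j).1) hRsymm
    (W := fun s θ => (N s θ).toBlocks₂₂) (fun i j => hNs (Sum.inr i) (Sum.inr j)) hRN
  have hTc : Continuous T := continuous_matrix fun i j => (hTd i j).continuous
  have hQc : Continuous (Function.uncurry Q) := continuous_matrix fun i j => (hQd i j).continuous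
  -- Positivity of the multiplier is tested on (0, u), which sees only the block τS(s) - εI.
  have hle : ∀ s ∈ Icc (-τ) 0, ∀ u, ε * (u ⬝ᵥ u) ≤ τ * (u ⬝ᵥ T s *ᵥ u) := fun s hs u => by
    have h1 := hMpos s hs (Sum.elim 0 u)
    rw [← fromBlocks_toBlocks (M s), fromBlocks_mulVec, sumElim_dotProduct_sumElim] at h1
    simp only [Sum.elim_comp_inl, Sum.elim_comp_inr, mulVec_zero, zero_add, zero_dotProduct] at h1
    rw [hTS s hs, hSW s hs, smul_mulVec, add_mulVec, smul_mulVec, one_mulVec, dotProduct_smul,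
      dotProduct_add, dotProduct_smul, smul_eq_mul, smul_eq_mul, mul_inv_cancel_left₀ hτ.ne']
    linarith
  have hcert : IsDualCertificate τ ε (toEuclideanCLM (𝕜 := ℝ) A₀) (toEuclideanCLM (𝕜 := ℝ) A₁)
      _ _ _ _ _ := isDualCertificate_of_forms hTd hTs hQd hQs hle
    (fun x z hz => by
      have h := form_nonneg_of_mem_Xi hτ hFH₁ hMN (continuous_dualM (τ := τ) (ε := ε) hTc hQc)
        (continuous_dualN hQc) 1
        ((ae_mem_delayInterval τ).mono fun s hs => by
          rw [one_smul]; exact dualM_congr hτ.le hTS hQR F₁ hs)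
        ((ae_mem_delayInterval_prod τ).mono fun p hp => by
          rw [one_smul]; exact dualN_congr hQR H₁ hp.1 hp.2) x hz
      rwa [one_mul] at h)
    (fun x z hz => by
      have h := form_nonneg_of_mem_Xi hτ hFH₂ hDE
        (continuous_dualD (τ := τ) (ε := ε) (A₀ := A₀) (A₁ := A₁) hTd hQd)
        (continuous_dualE hQd hQs) (-1)
        ((ae_mem_Ioo_delay τ).mono fun s hs => by
          rw [neg_one_smul]; exact congrArg Neg.neg (dualD_congr hτ.le hTS hQR F₂ hs))
        ((ae_mem_Ioo_delay_prod τ).mono fun p hp => by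
          rw [neg_one_smul]; exact congrArg Neg.neg (dualE_congr hQR H₂ hp.1 hp.2)) x hz
      linarith)
  obtain ⟨C, α, hC, hα, hdecay⟩ := hcert.exponentially_stable hτ hε
  refine ⟨C, α, hC, hα, fun φ x hx t ht => hdecay x hx.continuousOn (fun t ht => ?_) _
    (fun s hs => ?_) t ht⟩
  · refine (hx.equation t ht).congr_deriv ?_
    ext i
    simp [ofLp_toEuclideanCLM]
  · rw [hx.initial ⟨s, hs⟩]
    exact φ.norm_coe_le_norm _
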